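/- Conventions. An operator system is a matrix-ordered $*$-vector space over $\mathbb C$ (a complex $*$-vector space $V$ with proper convex cones $M_n(V)_+$ of hermitian matrices, $n\in\mathbb N$, such that $A^*M_m(V)_+A\subseteq M_n(V)_+$ for all scalar $m\times n$ matrices $A$) together with a distinguished Archimedean matrix order unit. A linear map $\phi:V\to W$ is positive if $\phi(V_+)\subseteq W_+$, and completely positive if its entrywise applications map $M_n(V)_+$ into $M_n(W)_+$ for every $n$. An operator system $\mathcal R$ is an OMAX system if every positive linear map from $\mathcal R$ into any operator system is completely positive; an operator system $\mathcal S$ is an OMIN system if every positive linear map from any operator system into $\mathcal S$ is completely positive. For a discrete group $G$, let $C^*(G)$ be the full group C$^*$-algebra. For $d\ge 2$, let $u_1,\dots,u_d$ be the canonical generators of $C^*(\mathbb Z_2*\cdots*\mathbb Z_2)$ ($d$ free factors), and put $\mathrm{NC}(d)=\operatorname{Span}\{1,u_1,\dots,u_d\}$. For $k\ge 2$, let $w$ and $v$ be the unitaries in $C^*(\mathbb Z_k*\mathbb Z_2)$ given by the generators of $\mathbb Z_k$ and $\mathbb Z_2$, and put $\mathrm{NCP}(k)=\operatorname{Span}\{1,w,w^2,\dots,w^{k-1},v\}$.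 Both are operator subsystems of these C$^*$-algebras, with unit $1$. For a finite-dimensional operator system $\mathcal R$, the dual $\mathcal R^\delta$ is the dual vector space with involution $f^*(x)=\overline{f(x^*)}$, in which a matrix $[f_{ij}]\in M_n(\mathcal R^\delta)$ is positive if the linear map $\mathcal R\to M_n(\mathbb C)$, $x\mapsto[f_{ij}(x)]$, is completely positive; the order unit is any chosen faithful state on $\mathcal R$. Theorem. Let $\mathcal R$ be $\mathrm{NC}(d)$ or $\mathrm{NCP}(k)$, where $d,k\geq 2$. (1) Every positive linear map from $\mathcal R$ into any operator system is completely positive; that is, $\mathcal R$ is an OMAX system. (2) There is a faithful state on $\mathcal R$, every faithful state on $\mathcal R$ is an Archimedean matrix order unit for $\mathcal R^\delta$, and with any such order unit $\mathcal R^\delta$ is an OMIN system: every positive linear map from any operator system into $\mathcal R^\delta$ is completely positive. -/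

import Mathlib

open scoped Matrix ComplexOrder

universe u

noncomputable section

/-- The complex group algebra `ℂ[G]` of a discrete group `G`. -/
def GroupAlg (G : Type u) : Type u := MonoidAlgebra ℂ G

namespace GroupAlg

instance instRing (G : Type u) [Group G] : Ring (GroupAlg G) :=
  inferInstanceAs (Ring (MonoidAlgebra ℂ G))

instance instAlgebra (G : Type u) [Group G] : Algebra ℂ (GroupAlg G) :=
  inferInstanceAs (Algebra ℂ (MonoidAlgebra ℂ G))

variable {G : Type u} [Group G]

/-- The element `c • g` of `ℂ[G]`. -/
def single (g : G) (c : ℂ) : GroupAlg G := MonoidAlgebra.single g c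

theorem single_add (g : G) (a b : ℂ) : single g (a + b) = single g a + single g b :=
  MonoidAlgebra.single_add g a b

theorem single_zero (g : G) : single g (0 : ℂ) = 0 := MonoidAlgebra.single_zero g

theorem single_mul (g h : G) (a b : ℂ) : single g a * single h b = single (g * h) (a * b) :=
  MonoidAlgebra.single_mul_single ..

theorem smul_single (c : ℂ) (g : G) (a : ℂ) : c • single g a = single g (c * a) :=
  MonoidAlgebra.smul_single ..

theorem one_def : (1 : GroupAlg G) = single 1 1 := MonoidAlgebra.one_def

theorem induction {p : GroupAlg G → Prop} (x : GroupAlg G) (h0 : p 0)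
    (hadd : ∀ x y, p x → p y → p (x + y)) (hs : ∀ g c, p (single g c)) : p x :=
  MonoidAlgebra.induction_linear (motive := p) x h0 hadd hs

/-- The involution of `ℂ[G]`, as an additive map: `∑ c_g g ↦ ∑ conj c_g g⁻¹`. -/
def starHom (G : Type u) [Group G] : GroupAlg G →+ GroupAlg G where
  toFun x := (MonoidAlgebra.coeff x).sum fun g c => single g⁻¹ (star c)
  map_zero' := by exact Finsupp.sum_zero_index
  map_add' x y := by
    exact Finsupp.sum_add_index' (f := MonoidAlgebra.coeff x) (g := MonoidAlgebra.coeff y)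
      (h := fun g c => single g⁻¹ (star c))
      (fun g => by simp [single_zero]) (fun g a b => by simp [single_add])

theorem starHom_single (g : G) (c : ℂ) : starHom G (single g c) = single g⁻¹ (star c) := by
  exact Finsupp.sum_single_index (h := fun g c => single g⁻¹ (star c)) (by simp [single_zero])

instance instStarRing : StarRing (GroupAlg G) where
  star x := starHom G x
  star_involutive x := by
    show starHom G (starHom G x) = x
    induction x using induction with
    | h0 => simp
    | hadd x y hx hy => simp [hx, hy]
    | hs g c => simp [starHom_single]
  star_add x y := map_add (starHom G) x y
  star_mul x y := by
    show starHom G (x * y) = starHom G y * starHom G x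
    induction x using induction with
    | h0 => simp
    | hadd x x' hx hy => simp [hx, hy, add_mul, mul_add]
    | hs g c =>
      induction y using induction with
      | h0 => simp
      | hadd x y hx hy => simp [hx, hy, add_mul, mul_add]
      | hs h d => simp [starHom_single, single_mul, mul_comm]

theorem star_single (g : G) (c : ℂ) : star (single g c) = single g⁻¹ (star c) :=
  starHom_single g c

instance instStarModule : StarModule ℂ (GroupAlg G) where
  star_smul c x := by
    induction x using induction with
    | h0 => simp
    | hadd x y hx hy => simp [hx, hy]
    | hs h d => simp [star_single, smul_single]

/-- The linear extension to `ℂ[G]` of a unitary representation of `G` on a Hilbert space `H`. -/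
def rep {H : Type u} [NormedAddCommGroup H] [InnerProductSpace ℂ H] [CompleteSpace H]
    (π : G →* unitary (H →L[ℂ] H)) : GroupAlg G →ₐ[ℂ] (H →L[ℂ] H) :=
  MonoidAlgebra.lift ℂ (H →L[ℂ] H) G ((unitary (H →L[ℂ] H)).subtype.comp π)

section Rep
variable {H : Type u} [NormedAddCommGroup H] [InnerProductSpace ℂ H] [CompleteSpace H]
    (π : G →* unitary (H →L[ℂ] H))

theorem rep_single (g : G) (c : ℂ) : rep π (single g c) = c • (π g : H →L[ℂ] H) :=
  MonoidAlgebra.lift_single ..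

theorem rep_star (x : GroupAlg G) : rep π (star x) = star (rep π x) := by
  induction x using induction with
  | h0 => simp
  | hadd x y hx hy => simp [hx, hy]
  | hs g c =>
    rw [star_single, rep_single, rep_single, star_smul, map_inv]
    rfl
end Rep

/-- The set of the numbers `‖π(x)‖`, where `π` runs over all unitary representations of `G` on
Hilbert spaces. -/
def repNorms (x : GroupAlg G) : Set ℝ :=
  {r | ∃ (H : Type u) (_ : NormedAddCommGroup H) (_ : InnerProductSpace ℂ H)
    (_ : CompleteSpace H) (π : G →* unitary (H →L[ℂ] H)), r = ‖rep π x‖}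

/-- The maximal (universal) C⋆-norm on `ℂ[G]`: the supremum of `‖π(x)‖` over all unitary
representations `π` of `G`. -/
def maxNorm (x : GroupAlg G) : ℝ := sSup (repNorms x)

theorem norm_coe_unitary_le {H : Type u} [NormedAddCommGroup H] [InnerProductSpace ℂ H]
    [CompleteSpace H] (U : unitary (H →L[ℂ] H)) : ‖(U : H →L[ℂ] H)‖ ≤ 1 := by
  have h : ‖(U : H →L[ℂ] H)‖ * ‖(U : H →L[ℂ] H)‖ ≤ 1 := by
    rw [← CStarRing.norm_star_mul_self, Unitary.coe_star_mul_self]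
    exact ContinuousLinearMap.norm_id_le
  nlinarith [norm_nonneg (U : H →L[ℂ] H)]

theorem bddAbove_repNorms (x : GroupAlg G) : BddAbove (repNorms x) := by
  induction x using induction with
  | h0 => exact ⟨0, by rintro r ⟨H, _, _, _, π, rfl⟩; simp⟩
  | hadd x y hx hy =>
    obtain ⟨a, ha⟩ := hx
    obtain ⟨b, hb⟩ := hy
    refine ⟨a + b, ?_⟩
    rintro r ⟨H, i1, i2, i3, π, rfl⟩
    rw [map_add]
    exact (norm_add_le _ _).trans (add_le_add (ha ⟨H, i1, i2, i3, π, rfl⟩)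
      (hb ⟨H, i1, i2, i3, π, rfl⟩))
  | hs g c =>
    refine ⟨‖c‖, ?_⟩
    rintro r ⟨H, _, _, _, π, rfl⟩
    rw [rep_single, norm_smul]
    exact mul_le_of_le_one_right (norm_nonneg _) (norm_coe_unitary_le _)

theorem norm_rep_le {H : Type u} [i1 : NormedAddCommGroup H] [i2 : InnerProductSpace ℂ H]
    [i3 : CompleteSpace H] (π : G →* unitary (H →L[ℂ] H)) (x : GroupAlg G) :
    ‖rep π x‖ ≤ maxNorm x :=
  le_csSup (bddAbove_repNorms x) ⟨H, i1, i2, i3, π, rfl⟩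

theorem maxNorm_le {x : GroupAlg G} {C : ℝ}
    (h : ∀ (H : Type u) [NormedAddCommGroup H] [InnerProductSpace ℂ H] [CompleteSpace H]
      (π : G →* unitary (H →L[ℂ] H)), ‖rep π x‖ ≤ C) : maxNorm x ≤ C := by
  refine csSup_le ⟨_, PUnit, inferInstance, inferInstance, inferInstance, 1, rfl⟩ ?_
  rintro r ⟨H, _, _, _, π, rfl⟩
  exact h H π

theorem maxNorm_nonneg (x : GroupAlg G) : 0 ≤ maxNorm x :=
  (norm_nonneg _).trans (norm_rep_le (H := PUnit) 1 x)

theorem maxNorm_zero : maxNorm (0 : GroupAlg G) = 0 :=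
  le_antisymm (maxNorm_le fun H _ _ _ π => by simp) (maxNorm_nonneg _)

theorem maxNorm_add_le (x y : GroupAlg G) : maxNorm (x + y) ≤ maxNorm x + maxNorm y :=
  maxNorm_le fun H _ _ _ π => by
    rw [map_add]
    exact (norm_add_le _ _).trans (add_le_add (norm_rep_le π x) (norm_rep_le π y))

theorem maxNorm_neg (x : GroupAlg G) : maxNorm (-x) = maxNorm x := by
  have h : ∀ y : GroupAlg G, maxNorm (-y) ≤ maxNorm y := fun y =>
    maxNorm_le fun H _ _ _ π => by rw [map_neg, norm_neg]; exact norm_rep_le π y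
  exact le_antisymm (h x) (by simpa using h (-x))

theorem maxNorm_mul_le (x y : GroupAlg G) : maxNorm (x * y) ≤ maxNorm x * maxNorm y :=
  maxNorm_le fun H _ _ _ π => by
    rw [map_mul]
    exact (norm_mul_le _ _).trans (mul_le_mul (norm_rep_le π x) (norm_rep_le π y)
      (norm_nonneg _) (maxNorm_nonneg _))

theorem maxNorm_smul_le (c : ℂ) (x : GroupAlg G) : maxNorm (c • x) ≤ ‖c‖ * maxNorm x :=
  maxNorm_le fun H _ _ _ π => by
    rw [map_smul, norm_smul]
    exact mul_le_mul_of_nonneg_left (norm_rep_le π x) (norm_nonneg _)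

theorem maxNorm_star (x : GroupAlg G) : maxNorm (star x) = maxNorm x := by
  have h : ∀ y : GroupAlg G, maxNorm (star y) ≤ maxNorm y := fun y =>
    maxNorm_le fun H _ _ _ π => by rw [rep_star, norm_star]; exact norm_rep_le π y
  exact le_antisymm (h x) (by simpa using h (star x))

theorem maxNorm_mul_self_le (x : GroupAlg G) : maxNorm x * maxNorm x ≤ maxNorm (star x * x) := by
  have h : maxNorm x ≤ √(maxNorm (star x * x)) := maxNorm_le fun H _ _ _ π => by
    apply Real.le_sqrt_of_sq_le
    rw [sq, ← CStarRing.norm_star_mul_self, ← rep_star, ← map_mul]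
    exact norm_rep_le π _
  calc _ ≤ √(maxNorm (star x * x)) * √(maxNorm (star x * x)) :=
        mul_self_le_mul_self (maxNorm_nonneg x) h
    _ = _ := Real.mul_self_sqrt (maxNorm_nonneg _)

/-- `maxNorm` as a seminorm on the additive group of `ℂ[G]`. -/
def maxSeminorm (G : Type u) [Group G] : AddGroupSeminorm (GroupAlg G) where
  toFun := maxNorm
  map_zero' := maxNorm_zero
  add_le' := maxNorm_add_le
  neg' := maxNorm_neg

instance instSeminormedRing : SeminormedRing (GroupAlg G) :=
  { instRing G, (maxSeminorm G).toSeminormedAddGroup with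
    norm_mul_le := maxNorm_mul_le }

theorem norm_def (x : GroupAlg G) : ‖x‖ = maxNorm x := rfl

instance instNormedAlgebra : NormedAlgebra ℂ (GroupAlg G) where
  norm_smul_le := maxNorm_smul_le

instance instNormedStarGroup : NormedStarGroup (GroupAlg G) where
  norm_star_le x := (maxNorm_star x).le

end GroupAlg

/-- The full group C⋆-algebra `C⋆(G)` of a discrete group `G`: the completion of `ℂ[G]` in the
maximal C⋆-norm. -/
def GroupCStar (G : Type u) [Group G] : Type u := UniformSpace.Completion (GroupAlg G)

namespace GroupCStar

open UniformSpace

variable {G : Type u} [Group G]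

instance instNormedRing : NormedRing (GroupCStar G) :=
  inferInstanceAs (NormedRing (Completion (GroupAlg G)))

instance instCompleteSpace : CompleteSpace (GroupCStar G) :=
  inferInstanceAs (CompleteSpace (Completion (GroupAlg G)))

instance instAlgebra : Algebra ℂ (GroupCStar G) :=
  inferInstanceAs (Algebra ℂ (Completion (GroupAlg G)))

instance instNormedAlgebra : NormedAlgebra ℂ (GroupCStar G) where
  norm_smul_le c a := norm_smul_le (α := ℂ) (β := Completion (GroupAlg G)) c a

/-- The canonical map `ℂ[G] → C⋆(G)`. -/
def coe (x : GroupAlg G) : GroupCStar G := (x : Completion (GroupAlg G))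

theorem coe_add (x y : GroupAlg G) : coe (x + y) = coe x + coe y := Completion.coe_add x y
theorem coe_mul (x y : GroupAlg G) : coe (x * y) = coe x * coe y := Completion.coe_mul x y
theorem coe_one : coe (1 : GroupAlg G) = 1 := rfl
theorem coe_smul (c : ℂ) (x : GroupAlg G) : coe (c • x) = c • coe x := Completion.coe_smul c x
theorem norm_coe (x : GroupAlg G) : ‖coe x‖ = ‖x‖ := Completion.norm_coe x
theorem continuous_coe : Continuous (coe : GroupAlg G → GroupCStar G) :=
  Completion.continuous_coe _
theorem denseRange_coe : DenseRange (coe : GroupAlg G → GroupCStar G) :=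
  Completion.denseRange_coe

/-- The involution of `C⋆(G)`: the continuous extension of the involution of `ℂ[G]`. -/
def starFun : GroupCStar G → GroupCStar G :=
  Completion.map (star : GroupAlg G → GroupAlg G)

theorem uniformContinuous_star : UniformContinuous (star : GroupAlg G → GroupAlg G) :=
  (starₗᵢ ℂ : GroupAlg G ≃ₗᵢ⋆[ℂ] GroupAlg G).isometry.uniformContinuous

theorem continuous_starFun : Continuous (starFun : GroupCStar G → GroupCStar G) :=
  Completion.continuous_map

theorem starFun_coe (x : GroupAlg G) : starFun (coe x) = coe (star x) :=
  Completion.map_coe uniformContinuous_star x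

theorem induction {p : GroupCStar G → Prop} (a : GroupCStar G) (hp : IsClosed {a | p a})
    (h : ∀ x : GroupAlg G, p (coe x)) : p a :=
  denseRange_coe.induction_on a hp h

theorem starFun_add (a b : GroupCStar G) : starFun (a + b) = starFun a + starFun b := by
  induction a using induction with
  | hp => exact isClosed_eq (continuous_starFun.comp (by fun_prop))
            (continuous_starFun.add continuous_const)
  | h x =>
    induction b using induction with
    | hp => exact isClosed_eq (continuous_starFun.comp (by fun_prop))
              (continuous_const.add continuous_starFun)
    | h y => rw [← coe_add, starFun_coe, starFun_coe, starFun_coe, star_add, coe_add]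

theorem starFun_mul (a b : GroupCStar G) : starFun (a * b) = starFun b * starFun a := by
  induction a using induction with
  | hp => exact isClosed_eq (continuous_starFun.comp (by fun_prop))
            (continuous_const.mul continuous_starFun)
  | h x =>
    induction b using induction with
    | hp => exact isClosed_eq (continuous_starFun.comp (by fun_prop))
              (continuous_starFun.mul continuous_const)
    | h y => rw [← coe_mul, starFun_coe, starFun_coe, starFun_coe, star_mul, coe_mul]

theorem starFun_starFun (a : GroupCStar G) : starFun (starFun a) = a := by
  induction a using induction with
  | hp => exact isClosed_eq (continuous_starFun.comp continuous_starFun) continuous_id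
  | h x => rw [starFun_coe, starFun_coe, star_star]

theorem starFun_smul (c : ℂ) (a : GroupCStar G) : starFun (c • a) = star c • starFun a := by
  induction a using induction with
  | hp =>
    have hc (d : ℂ) : Continuous fun b : GroupCStar G => d • b := continuous_const_smul d
    exact isClosed_eq (continuous_starFun.comp (hc c)) ((hc (star c)).comp continuous_starFun)
  | h x => rw [← coe_smul, starFun_coe, starFun_coe, star_smul, coe_smul]

theorem norm_mul_self_le_starFun (a : GroupCStar G) : ‖a‖ * ‖a‖ ≤ ‖starFun a * a‖ := by
  induction a using induction with
  | hp => exact isClosed_le (by fun_prop) ((continuous_starFun.mul continuous_id).norm)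
  | h x =>
    rw [starFun_coe, ← coe_mul, norm_coe, norm_coe]
    exact GroupAlg.maxNorm_mul_self_le x

instance instStarRing : StarRing (GroupCStar G) where
  star := starFun
  star_involutive := starFun_starFun
  star_mul := starFun_mul
  star_add := starFun_add

instance instCStarAlgebra : CStarAlgebra (GroupCStar G) where
  norm_mul_self_le := norm_mul_self_le_starFun
  star_smul := starFun_smul

theorem star_coe (x : GroupAlg G) : star (coe x) = coe (star x) := starFun_coe x

/-- The canonical unitary in `C⋆(G)` of a group element. -/
def of (g : G) : GroupCStar G := coe (GroupAlg.single g 1)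

theorem of_one : of (1 : G) = 1 := by rw [of, ← GroupAlg.one_def, coe_one]

theorem of_mul (g h : G) : of (g * h) = of g * of h := by
  rw [of, of, of, ← coe_mul, GroupAlg.single_mul, one_mul]

theorem of_pow (g : G) (n : ℕ) : of (g ^ n) = of g ^ n := by
  induction n with
  | zero => rw [pow_zero, pow_zero, of_one]
  | succ n ih => rw [pow_succ, pow_succ, of_mul, ih]

theorem star_of (g : G) : star (of g) = of g⁻¹ := by
  rw [of, of, star_coe, GroupAlg.star_single, star_one]

end GroupCStar

section MatrixOrder

/-- The congruence `A⋆ M A` of a matrix `M` over a complex vector space by a scalar matrix `A`. -/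
def scalarCongr {V : Type*} [AddCommGroup V] [Module ℂ V] {m n : ℕ}
    (A : Matrix (Fin m) (Fin n) ℂ) (M : Matrix (Fin m) (Fin m) V) : Matrix (Fin n) (Fin n) V :=
  fun i j => ∑ k, ∑ l, (star (A k i) * A l j) • M k l

/-- A matrix-ordered `⋆`-vector space: a complex `⋆`-vector space `V` with a proper convex cone of
Hermitian matrices in each `M_n(V)`, compatible under congruences by scalar matrices. -/
class MatrixOrderedSpace (V : Type*) [AddCommGroup V] [Module ℂ V] [StarAddMonoid V]
    [StarModule ℂ V] where
  /-- The cone `M_n(V)_+`. -/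
  matCone : ∀ n : ℕ, Set (Matrix (Fin n) (Fin n) V)
  isHermitian_of_mem : ∀ {n : ℕ} {M : Matrix (Fin n) (Fin n) V}, M ∈ matCone n → M.IsHermitian
  zero_mem : ∀ n : ℕ, (0 : Matrix (Fin n) (Fin n) V) ∈ matCone n
  add_mem : ∀ {n : ℕ} {M N : Matrix (Fin n) (Fin n) V},
    M ∈ matCone n → N ∈ matCone n → M + N ∈ matCone n
  smul_mem : ∀ {n : ℕ} {M : Matrix (Fin n) (Fin n) V} {r : ℝ},
    0 ≤ r → M ∈ matCone n → (r : ℂ) • M ∈ matCone n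
  eq_zero_of_mem_of_neg_mem : ∀ {n : ℕ} {M : Matrix (Fin n) (Fin n) V},
    M ∈ matCone n → -M ∈ matCone n → M = 0
  scalarCongr_mem : ∀ {m n : ℕ} (A : Matrix (Fin m) (Fin n) ℂ) {M : Matrix (Fin m) (Fin m) V},
    M ∈ matCone m → scalarCongr A M ∈ matCone n

open MatrixOrderedSpace

/-- `e` is an Archimedean matrix order unit: `e = e⋆`, and in each `M_n(V)` the diagonal matrix
`e_n` with entries `e` is an order unit for the Hermitian matrices which is Archimedean. -/
def IsArchimedeanMatrixOrderUnit {V : Type*} [AddCommGroup V] [Module ℂ V] [StarAddMonoid V]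
    [StarModule ℂ V] [MatrixOrderedSpace V] (e : V) : Prop :=
  star e = e ∧ ∀ n : ℕ,
    (∀ M : Matrix (Fin n) (Fin n) V, M.IsHermitian →
      ∃ r : ℝ, 0 < r ∧ (r : ℂ) • Matrix.diagonal (fun _ => e) + M ∈ matCone n) ∧
    (∀ M : Matrix (Fin n) (Fin n) V,
      (∀ r : ℝ, 0 < r → (r : ℂ) • Matrix.diagonal (fun _ => e) + M ∈ matCone n) →
      M ∈ matCone n)

/-- An (abstract) operator system in the sense of Choi and Effros: a matrix-ordered `⋆`-vector
space with a distinguished Archimedean matrix order unit. -/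
class OperatorSystem (V : Type*) [AddCommGroup V] [Module ℂ V] [StarAddMonoid V]
    [StarModule ℂ V] extends MatrixOrderedSpace V where
  /-- The distinguished Archimedean matrix order unit. -/
  unit : V
  isArchimedeanMatrixOrderUnit_unit : IsArchimedeanMatrixOrderUnit unit

section Maps

variable {V W : Type*} [AddCommGroup V] [Module ℂ V] [StarAddMonoid V] [StarModule ℂ V]
  [MatrixOrderedSpace V] [AddCommGroup W] [Module ℂ W] [StarAddMonoid W] [StarModule ℂ W]
  [MatrixOrderedSpace W]

/-- A linear map is `n`-positive if its entrywise application maps `M_n(V)_+` into `M_n(W)_+`. -/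
def IsNPositive (n : ℕ) (φ : V →ₗ[ℂ] W) : Prop :=
  ∀ M : Matrix (Fin n) (Fin n) V, M ∈ matCone n → M.map φ ∈ matCone n

/-- A linear map is positive if it is `1`-positive. -/
def IsPositiveMap (φ : V →ₗ[ℂ] W) : Prop := IsNPositive 1 φ

/-- A linear map is completely positive if it is `n`-positive for all `n`. -/
def IsCompletelyPositiveMap (φ : V →ₗ[ℂ] W) : Prop := ∀ n : ℕ, IsNPositive n φ

end Maps

/-- `R` is an OMAX operator system: every positive linear map from `R` into any operator system
is completely positive. -/
def IsOMAX.{v, w} (R : Type w) [AddCommGroup R] [Module ℂ R] [StarAddMonoid R] [StarModule ℂ R]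
    [MatrixOrderedSpace R] : Prop :=
  ∀ (T : Type v) [AddCommGroup T] [Module ℂ T] [StarAddMonoid T] [StarModule ℂ T]
    [OperatorSystem T] (φ : R →ₗ[ℂ] T), IsPositiveMap φ → IsCompletelyPositiveMap φ

/-- `S` is an OMIN operator system: every positive linear map from any operator system into `S`
is completely positive. -/
def IsOMIN.{v, w} (S : Type w) [AddCommGroup S] [Module ℂ S] [StarAddMonoid S] [StarModule ℂ S]
    [MatrixOrderedSpace S] : Prop :=
  ∀ (U : Type v) [AddCommGroup U] [Module ℂ U] [StarAddMonoid U] [StarModule ℂ U]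
    [OperatorSystem U] (φ : U →ₗ[ℂ] S), IsPositiveMap φ → IsCompletelyPositiveMap φ

end MatrixOrder

section MatrixAlgebra

open MatrixOrderedSpace

theorem comp_scalarCongr {q m n : ℕ} (A : Matrix (Fin m) (Fin n) ℂ)
    (M : Matrix (Fin m) (Fin m) (Matrix (Fin q) (Fin q) ℂ)) :
    Matrix.comp _ _ _ _ ℂ (scalarCongr A M) =
      (Matrix.kroneckerMap (· * ·) A (1 : Matrix (Fin q) (Fin q) ℂ))ᴴ *
        Matrix.comp _ _ _ _ ℂ M *
        (Matrix.kroneckerMap (· * ·) A (1 : Matrix (Fin q) (Fin q) ℂ)) := by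
  ext ⟨i, a⟩ ⟨j, b⟩
  simp only [Matrix.comp_apply, scalarCongr, Matrix.mul_apply, Matrix.conjTranspose_apply,
    Matrix.kroneckerMap_apply, Fintype.sum_prod_type, Matrix.sum_apply, Matrix.smul_apply,
    smul_eq_mul, Matrix.one_apply, Finset.sum_mul]
  simp only [mul_ite, mul_one, mul_zero, apply_ite star, star_zero, ite_mul, zero_mul]
  rw [Finset.sum_comm]
  simp [mul_right_comm]

/-- The matrix algebra `M_q(ℂ)` is matrix-ordered: a matrix in `M_n(M_q(ℂ))` is positive if it is
positive semidefinite as a block matrix in `M_{nq}(ℂ)`. -/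
instance instMatrixOrderedSpaceMatrix (q : ℕ) :
    MatrixOrderedSpace (Matrix (Fin q) (Fin q) ℂ) where
  matCone n := {M | (Matrix.comp (Fin n) (Fin n) (Fin q) (Fin q) ℂ M).PosSemidef}
  isHermitian_of_mem {n M} h := by
    ext i j a b
    have := congrFun (congrFun h.isHermitian (i, a)) (j, b)
    simpa using this
  zero_mem n := Matrix.PosSemidef.zero
  add_mem h h' := Matrix.PosSemidef.add h h'
  smul_mem {n M r} hr h := by
    have h0 : (0 : ℂ) ≤ (r : ℂ) := by exact_mod_cast hr
    exact Matrix.PosSemidef.smul (x := Matrix.comp (Fin n) (Fin n) (Fin q) (Fin q) ℂ M) h h0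
  eq_zero_of_mem_of_neg_mem {n M} h h' := by
    have h1 : Matrix.comp (Fin n) (Fin n) (Fin q) (Fin q) ℂ M = 0 :=
      open scoped MatrixOrder in
      le_antisymm (Matrix.le_iff.2 (by rw [zero_sub]; exact h'))
        (Matrix.nonneg_iff_posSemidef.2 h)
    ext i j a b
    exact congrFun (congrFun h1 (i, a)) (j, b)
  scalarCongr_mem A M h := by
    rw [Set.mem_ofPred_eq, comp_scalarCongr]
    exact h.conjTranspose_mul_mul_same _

end MatrixAlgebra

section Dual

open MatrixOrderedSpace

/-- The dual space of (the underlying vector space of) a finite-dimensional operator system `V`. -/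
def OSDual (V : Type*) [AddCommGroup V] [Module ℂ V] : Type _ := Module.Dual ℂ V

namespace OSDual

variable {V : Type*} [AddCommGroup V] [Module ℂ V]

instance instAddCommGroup : AddCommGroup (OSDual V) :=
  inferInstanceAs (AddCommGroup (Module.Dual ℂ V))

instance instModule : Module ℂ (OSDual V) := inferInstanceAs (Module ℂ (Module.Dual ℂ V))

instance instFunLike : FunLike (OSDual V) V ℂ := inferInstanceAs (FunLike (Module.Dual ℂ V) V ℂ)

theorem ext {f g : OSDual V} (h : ∀ x, f x = g x) : f = g := LinearMap.ext h

theorem map_add (f : OSDual V) (x y : V) : f (x + y) = f x + f y := LinearMap.map_add f x y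

theorem map_smul (f : OSDual V) (c : ℂ) (x : V) : f (c • x) = c • f x := LinearMap.map_smul f c x

theorem add_apply (f g : OSDual V) (x : V) : (f + g) x = f x + g x := rfl

theorem smul_apply (c : ℂ) (f : OSDual V) (x : V) : (c • f) x = c • f x := rfl

theorem neg_apply (f : OSDual V) (x : V) : (-f) x = -f x := rfl

theorem zero_apply (x : V) : (0 : OSDual V) x = 0 := rfl

theorem sum_apply {ι : Type*} (s : Finset ι) (f : ι → OSDual V) (x : V) :
    (∑ i ∈ s, f i) x = ∑ i ∈ s, f i x :=
  LinearMap.sum_apply s f x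

/-- The linear map `V → M_n(ℂ)`, `x ↦ [f_{ij}(x)]`, of a matrix `[f_{ij}]` of functionals. -/
def hat {n : ℕ} (F : Matrix (Fin n) (Fin n) (OSDual V)) : V →ₗ[ℂ] Matrix (Fin n) (Fin n) ℂ where
  toFun x := Matrix.of fun i j => F i j x
  map_add' x y := by ext i j; exact map_add (F i j) x y
  map_smul' c x := by ext i j; exact map_smul (F i j) c x

theorem hat_apply {n : ℕ} (F : Matrix (Fin n) (Fin n) (OSDual V)) (x : V) (i j : Fin n) :
    hat F x i j = F i j x := rfl

theorem comp_map_hat_scalarCongr {k m n : ℕ} (A : Matrix (Fin m) (Fin n) ℂ)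
    (F : Matrix (Fin m) (Fin m) (OSDual V)) (M : Matrix (Fin k) (Fin k) V) :
    Matrix.comp _ _ _ _ ℂ (M.map (hat (scalarCongr A F))) =
      (Matrix.kroneckerMap (· * ·) (1 : Matrix (Fin k) (Fin k) ℂ) A)ᴴ *
        Matrix.comp _ _ _ _ ℂ (M.map (hat F)) *
        (Matrix.kroneckerMap (· * ·) (1 : Matrix (Fin k) (Fin k) ℂ) A) := by
  ext ⟨p, i⟩ ⟨q, j⟩
  simp only [Matrix.comp_apply, Matrix.map_apply, hat_apply, scalarCongr, sum_apply, smul_apply,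
    Matrix.mul_apply, Matrix.conjTranspose_apply, Matrix.kroneckerMap_apply,
    Fintype.sum_prod_type, smul_eq_mul, Matrix.one_apply, Finset.sum_mul]
  simp only [ite_mul, one_mul, zero_mul, apply_ite star, star_zero, mul_ite, mul_zero]
  rw [Finset.sum_comm]
  simp [mul_right_comm]

variable [StarAddMonoid V] [StarModule ℂ V]

/-- The involution on the dual space: `f⋆(x) = conj (f (x⋆))`. -/
instance instStarAddMonoid : StarAddMonoid (OSDual V) where
  star f :=
    { toFun := fun x => star (f (star x))
      map_add' := fun x y => by rw [star_add, map_add, star_add]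
      map_smul' := fun c x => by simp [star_smul, map_smul] }
  star_involutive f := ext fun x => by
    show star (star (f (star (star x)))) = f x
    rw [star_star, star_star]
  star_add f g := ext fun x => star_add (f (star x)) (g (star x))

theorem star_apply (f : OSDual V) (x : V) : (star f) x = star (f (star x)) := rfl

instance instStarModule : StarModule ℂ (OSDual V) where
  star_smul c f := ext fun x => star_smul c (f (star x))

variable [OperatorSystem V]

/-- The `1 × 1` matrix with entry `x`. -/
def oneByOne (x : V) : Matrix (Fin 1) (Fin 1) V := Matrix.of fun _ _ => x

theorem exists_pos_decomp_of_star_eq (x : V) (hx : star x = x) :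
    ∃ p q : V, oneByOne p ∈ matCone 1 ∧ oneByOne q ∈ matCone 1 ∧ x = p - q := by
  obtain ⟨-, hu⟩ := OperatorSystem.isArchimedeanMatrixOrderUnit_unit (V := V)
  obtain ⟨r, hr, hp⟩ := (hu 1).1 (oneByOne x) (by ext i j; exact hx)
  obtain ⟨s, hs, hq⟩ := (hu 1).1 0 (by ext i j; exact star_zero V)
  refine ⟨(r : ℂ) • OperatorSystem.unit + x, (r : ℂ) • OperatorSystem.unit, ?_, ?_, ?_⟩
  · convert hp using 1
    ext i j
    simp [oneByOne, Subsingleton.elim i j]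
  · have := smul_mem (div_nonneg hr.le hs.le) hq
    convert this using 1
    ext i j
    have hs' : ((r / s : ℝ) : ℂ) * (s : ℂ) = r := by
      rw [← Complex.ofReal_mul, div_mul_cancel₀ _ hs.ne']
    rw [add_zero, smul_smul, hs', Subsingleton.elim i j]
    simp [oneByOne]
  · abel

theorem exists_pos_decomp (x : V) :
    ∃ p q p' q' : V, oneByOne p ∈ matCone 1 ∧ oneByOne q ∈ matCone 1 ∧
      oneByOne p' ∈ matCone 1 ∧ oneByOne q' ∈ matCone 1 ∧
      x = (p - q) + Complex.I • (p' - q') := by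
  obtain ⟨p, q, hp, hq, h⟩ := exists_pos_decomp_of_star_eq (realPart x : V) (realPart x).2
  obtain ⟨p', q', hp', hq', h'⟩ :=
    exists_pos_decomp_of_star_eq (imaginaryPart x : V) (imaginaryPart x).2
  exact ⟨p, q, p', q', hp, hq, hp', hq', by
    rw [← h, ← h', realPart_add_I_smul_imaginaryPart]⟩

theorem star_eq_of_oneByOne_mem {W : Type*} [AddCommGroup W] [Module ℂ W] [StarAddMonoid W]
    [StarModule ℂ W] [MatrixOrderedSpace W] {p : W}
    (hp : (Matrix.of fun _ _ => p : Matrix (Fin 1) (Fin 1) W) ∈ matCone 1) : star p = p :=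
  congrFun (congrFun (isHermitian_of_mem hp) 0) 0

theorem map_star_of_isPositiveMap {W : Type*} [AddCommGroup W] [Module ℂ W] [StarAddMonoid W]
    [StarModule ℂ W] [MatrixOrderedSpace W] {φ : V →ₗ[ℂ] W} (hφ : IsPositiveMap φ) (x : V) :
    φ (star x) = star (φ x) := by
  have key : ∀ p : V, oneByOne p ∈ matCone 1 → star p = p ∧ star (φ p) = φ p := fun p hp =>
    ⟨star_eq_of_oneByOne_mem hp, star_eq_of_oneByOne_mem (hφ _ hp)⟩
  obtain ⟨p, q, p', q', hp, hq, hp', hq', rfl⟩ := exists_pos_decomp x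
  simp [star_smul, (key p hp).1, (key q hq).1, (key p' hp').1, (key q' hq').1,
    (key p hp).2, (key q hq).2, (key p' hp').2, (key q' hq').2]

/-- The matrix order of the dual: `[f_{ij}] ∈ M_n(V^δ)` is positive if the linear map
`x ↦ [f_{ij}(x)]` from `V` to `M_n(ℂ)` is completely positive. -/
instance instMatrixOrderedSpace : MatrixOrderedSpace (OSDual V) where
  matCone n := {F | IsCompletelyPositiveMap (hat F)}
  isHermitian_of_mem {n F} h := by
    ext i j : 2
    refine ext fun x => ?_
    have := map_star_of_isPositiveMap (φ := hat F) (h 1) (star x)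
    rw [star_star] at this
    exact (congrFun (congrFun this i) j).symm
  zero_mem n := by
    intro k M hM
    exact zero_mem k
  add_mem h h' := fun k M hM => add_mem (h k M hM) (h' k M hM)
  smul_mem hr h := fun k M hM => smul_mem hr (h k M hM)
  eq_zero_of_mem_of_neg_mem {n F} h h' := by
    have key : ∀ p : V, oneByOne p ∈ matCone 1 → hat F p = 0 := fun p hp => by
      have := eq_zero_of_mem_of_neg_mem (h 1 _ hp) (h' 1 _ hp)
      exact congrFun (congrFun this 0) 0
    ext i j : 2
    refine ext fun x => ?_
    obtain ⟨p, q, p', q', hp, hq, hp', hq', rfl⟩ := exists_pos_decomp x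
    have : hat F ((p - q) + Complex.I • (p' - q')) = 0 := by
      simp [key p hp, key q hq, key p' hp', key q' hq']
    exact congrFun (congrFun this i) j
  scalarCongr_mem A F h := fun k M hM => by
    have := h k M hM
    show (Matrix.comp _ _ _ _ ℂ (M.map (hat (scalarCongr A F)))).PosSemidef
    rw [comp_map_hat_scalarCongr]
    exact Matrix.PosSemidef.conjTranspose_mul_mul_same this _

/-- A faithful state on `V`: a unital positive linear functional that vanishes at no nonzero
positive element. -/
def IsFaithfulState (f : OSDual V) : Prop :=
  f OperatorSystem.unit = 1 ∧
    ∀ p : V, oneByOne p ∈ matCone 1 → 0 ≤ f p ∧ (f p = 0 → p = 0)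

end OSDual

end Dual

section OperatorSubsystem

/-- An operator subsystem of a unital C⋆-algebra: a self-adjoint linear subspace containing `1`. -/
structure OperatorSubsystem (A : Type*) [CStarAlgebra A] where
  toSubmodule : Submodule ℂ A
  one_mem : (1 : A) ∈ toSubmodule
  star_mem : ∀ {a : A}, a ∈ toSubmodule → star a ∈ toSubmodule

namespace OperatorSubsystem

variable {A : Type*} [CStarAlgebra A]

instance instCoeSort : CoeSort (OperatorSubsystem A) (Type _) := ⟨fun S => S.toSubmodule⟩

instance instStarAddMonoid (S : OperatorSubsystem A) : StarAddMonoid S where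
  star x := ⟨star (x : A), S.star_mem x.2⟩
  star_involutive x := Subtype.ext (star_star (x : A))
  star_add x y := Subtype.ext (star_add (x : A) (y : A))

instance instStarModule (S : OperatorSubsystem A) : StarModule ℂ S where
  star_smul c x := Subtype.ext (star_smul c (x : A))

section Aux

theorem nonneg_iff_exists {B : Type*} [NonUnitalCStarAlgebra B] [PartialOrder B]
    [StarOrderedRing B] (a : B) : 0 ≤ a ↔ ∃ b, a = star b * b :=
  CStarAlgebra.nonneg_iff_eq_star_mul_self

theorem exists_nonneg_smul_one_add {B : Type*} [CStarAlgebra B] [PartialOrder B]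
    [StarOrderedRing B] (a : B) (ha : IsSelfAdjoint a) :
    ∃ r : ℝ, 0 < r ∧ 0 ≤ (r : ℂ) • (1 : B) + a := by
  refine ⟨‖-a‖ + 1, by positivity, ?_⟩
  have h := IsSelfAdjoint.le_algebraMap_norm_self ha.neg
  have h1 : (0 : B) ≤ algebraMap ℝ B ‖-a‖ + a := by
    have := sub_nonneg.2 h
    rwa [sub_neg_eq_add] at this
  have h2 : (((‖-a‖ + 1 : ℝ) : ℂ) • (1 : B) + a) = (algebraMap ℝ B ‖-a‖ + a) + star 1 * 1 := by
    rw [Complex.coe_smul, Algebra.algebraMap_eq_smul_one, add_smul, star_one, one_mul, one_smul]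
    abel
  rw [h2]
  exact add_nonneg h1 (star_mul_self_nonneg 1)

theorem nonneg_of_forall {B : Type*} [CStarAlgebra B] [PartialOrder B]
    [StarOrderedRing B] (a : B) (ha : ∀ r : ℝ, 0 < r → 0 ≤ (r : ℂ) • (1 : B) + a) : 0 ≤ a := by
  have hc : Continuous fun r : ℝ => (r : ℂ) • (1 : B) + a := by fun_prop
  have ht : Filter.Tendsto (fun r : ℝ => (r : ℂ) • (1 : B) + a) (nhdsWithin 0 (Set.Ioi 0))
      (nhds a) := by
    have := (hc.tendsto 0).mono_left (nhdsWithin_le_nhds (s := Set.Ioi 0))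
    simpa using this
  exact CStarAlgebra.isClosed_nonneg.mem_of_tendsto ht
    (Filter.eventually_of_mem self_mem_nhdsWithin fun r hr => ha r hr)

theorem exists_eq_iff_nonneg [PartialOrder A] [StarOrderedRing A] {n : ℕ}
    (M : Matrix (Fin n) (Fin n) A) :
    (∃ B : Matrix (Fin n) (Fin n) A, M = Bᴴ * B) ↔ 0 ≤ CStarMatrix.ofMatrix M :=
  (nonneg_iff_exists (CStarMatrix.ofMatrix M)).symm

theorem rect_nonneg [PartialOrder A] [StarOrderedRing A] {m n : ℕ}
    (C : Matrix (Fin m) (Fin n) A) : 0 ≤ CStarMatrix.ofMatrix (Cᴴ * C) := by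
  rcases Nat.eq_zero_or_pos n with rfl | hn
  · exact le_of_eq (by ext i; exact i.elim0)
  let D : Fin m → Matrix (Fin n) (Fin n) A := fun k =>
    Matrix.of fun i j => if i = ⟨0, hn⟩ then C k j else 0
  have h : CStarMatrix.ofMatrix (Cᴴ * C) =
      ∑ k, CStarMatrix.ofMatrix ((D k)ᴴ * D k) := by
    have h1 : Cᴴ * C = ∑ k, (D k)ᴴ * D k := by
      ext i j
      simp [Matrix.sum_apply, Matrix.mul_apply, D, apply_ite star]
    rw [h1]
    exact map_sum (CStarMatrix.ofMatrixₗ (R := ℂ)) _ _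
  rw [h]
  exact Finset.sum_nonneg fun k _ => (exists_eq_iff_nonneg _).1 ⟨_, rfl⟩

end Aux

/-- The matrix order inherited from the C⋆-algebra: a matrix in `M_n(S)` is positive if it
is positive in the C⋆-algebra `M_n(A)`, that is, of the form `B⋆ B` with `B ∈ M_n(A)`. -/
instance instMatrixOrderedSpace (S : OperatorSubsystem A) : MatrixOrderedSpace S where
  matCone n := {M | ∃ B : Matrix (Fin n) (Fin n) A, M.map (fun x => (x : A)) = Bᴴ * B}
  isHermitian_of_mem {n M} h := by
    obtain ⟨B, hB⟩ := h
    have h1 : (M.map (fun x => (x : A))).IsHermitian := by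
      rw [hB]; exact Matrix.isHermitian_conjTranspose_mul_self B
    ext i j
    exact congrFun (congrFun h1 i) j
  zero_mem n := ⟨0, by ext i j; simp⟩
  add_mem := by
    intro n M N hM hN
    let _ := CStarAlgebra.spectralOrder A
    let _ := CStarAlgebra.spectralOrderedRing A
    rw [Set.mem_ofPred_eq, exists_eq_iff_nonneg] at *
    exact add_nonneg hM hN
  smul_mem {n M r} hr := by
    rintro ⟨B, hB⟩
    refine ⟨((√r : ℝ) : ℂ) • B, ?_⟩
    have h1 : (((r : ℂ) • M).map (fun x => (x : A))) = (r : ℂ) • M.map (fun x => (x : A)) := rfl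
    rw [h1, hB, Matrix.conjTranspose_smul, Matrix.smul_mul, Matrix.mul_smul, smul_smul,
      Complex.star_def, Complex.conj_ofReal, ← Complex.ofReal_mul, Real.mul_self_sqrt hr]
  eq_zero_of_mem_of_neg_mem := by
    intro n M hM hN
    let _ := CStarAlgebra.spectralOrder A
    let _ := CStarAlgebra.spectralOrderedRing A
    rw [Set.mem_ofPred_eq, exists_eq_iff_nonneg] at *
    have h := le_antisymm (neg_nonneg.1 hN) hM
    ext i j
    exact congrFun (congrFun h i) j
  scalarCongr_mem := by
    rintro m n C M ⟨B, hB⟩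
    let _ := CStarAlgebra.spectralOrder A
    let _ := CStarAlgebra.spectralOrderedRing A
    rw [Set.mem_ofPred_eq, exists_eq_iff_nonneg]
    have h : (scalarCongr C M).map (fun x => (x : A)) =
        (B * C.map (algebraMap ℂ A))ᴴ * (B * C.map (algebraMap ℂ A)) := by
      rw [Matrix.conjTranspose_mul, Matrix.mul_assoc, ← Matrix.mul_assoc Bᴴ, ← hB]
      ext i j
      simp only [Matrix.map_apply, scalarCongr, Matrix.mul_apply, Matrix.conjTranspose_apply,
        AddSubmonoidClass.coe_finsetSum, Submodule.coe_smul, Finset.mul_sum]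
      refine Finset.sum_congr rfl fun k _ => Finset.sum_congr rfl fun l _ => ?_
      rw [← algebraMap_star_comm, ← Algebra.commutes (C l j), ← mul_assoc, ← map_mul,
        ← Algebra.smul_def]
    rw [h]
    exact rect_nonneg _

theorem mem_matCone_iff (S : OperatorSubsystem A) {n : ℕ} (M : Matrix (Fin n) (Fin n) S) :
    M ∈ MatrixOrderedSpace.matCone n ↔
      ∃ B : Matrix (Fin n) (Fin n) A, M.map (fun x => (x : A)) = Bᴴ * B :=
  Iff.rfl

/-- An operator subsystem of a unital C⋆-algebra is an operator system with unit `1`. -/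
instance instOperatorSystem (S : OperatorSubsystem A) : OperatorSystem S where
  unit := ⟨1, S.one_mem⟩
  isArchimedeanMatrixOrderUnit_unit := by
    let _ := CStarAlgebra.spectralOrder A
    let _ := CStarAlgebra.spectralOrderedRing A
    have hdiag (n : ℕ) (r : ℝ) (M : Matrix (Fin n) (Fin n) S) :
        CStarMatrix.ofMatrix (((r : ℂ) • Matrix.diagonal (fun _ => (⟨1, S.one_mem⟩ : S)) + M).map
          (fun x => (x : A))) =
        (r : ℂ) • (1 : CStarMatrix (Fin n) (Fin n) A) +
          CStarMatrix.ofMatrix (M.map (fun x => (x : A))) := by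
      ext i j
      by_cases hij : i = j
      · subst hij
        simp [-Complex.coe_smul]
      · simp [hij, -Complex.coe_smul]
    refine ⟨Subtype.ext (star_one A), fun n => ⟨fun M hM => ?_, fun M hM => ?_⟩⟩
    · obtain ⟨r, hr, h⟩ := exists_nonneg_smul_one_add
        (CStarMatrix.ofMatrix (M.map (fun x => (x : A))))
        (by ext i j; exact congrArg Subtype.val (congrFun (congrFun hM i) j))
      refine ⟨r, hr, ?_⟩
      rw [mem_matCone_iff, exists_eq_iff_nonneg, hdiag]
      exact h
    · rw [mem_matCone_iff, exists_eq_iff_nonneg]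
      refine nonneg_of_forall _ fun r hr => ?_
      have h := hM r hr
      rw [mem_matCone_iff, exists_eq_iff_nonneg, hdiag] at h
      exact h

end OperatorSubsystem

end OperatorSubsystem

section NoncommutativeCubesAndPrisms

/-- The free product `ℤ₂ * ⋯ * ℤ₂` of `d` copies of `ℤ₂`. -/
abbrev CubeGroup (d : ℕ) : Type := Monoid.CoprodI fun _ : Fin d => Multiplicative (ZMod 2)

/-- The free product `ℤ_k * ℤ₂`. -/
abbrev PrismGroup (k : ℕ) : Type :=
  Monoid.Coprod (Multiplicative (ZMod k)) (Multiplicative (ZMod 2))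

/-- The canonical generator `u_j` of `C⋆(ℤ₂ * ⋯ * ℤ₂)`. -/
def cubeU (d : ℕ) (j : Fin d) : GroupCStar (CubeGroup d) :=
  GroupCStar.of (Monoid.CoprodI.of (i := j) (Multiplicative.ofAdd (1 : ZMod 2)))

/-- The canonical generator `w` of order `k` of `C⋆(ℤ_k * ℤ₂)`. -/
def prismW (k : ℕ) : GroupCStar (PrismGroup k) :=
  GroupCStar.of (Monoid.Coprod.inl (Multiplicative.ofAdd (1 : ZMod k)))

/-- The canonical generator `v` of order two of `C⋆(ℤ_k * ℤ₂)`. -/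
def prismV (k : ℕ) : GroupCStar (PrismGroup k) :=
  GroupCStar.of (Monoid.Coprod.inr (Multiplicative.ofAdd (1 : ZMod 2)))

theorem star_mem_span_of_star_mem {A : Type*} [CStarAlgebra A] {s : Set A}
    (hs : ∀ a ∈ s, star a ∈ Submodule.span ℂ s) {a : A} (ha : a ∈ Submodule.span ℂ s) :
    star a ∈ Submodule.span ℂ s := by
  induction ha using Submodule.span_induction with
  | mem x hx => exact hs x hx
  | zero => simp
  | add x y _ _ hx hy => rw [star_add]; exact add_mem hx hy
  | smul c x _ hx => rw [star_smul]; exact Submodule.smul_mem _ _ hx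

theorem inv_ofAdd_one_zmod_two :
    (Multiplicative.ofAdd (1 : ZMod 2))⁻¹ = Multiplicative.ofAdd (1 : ZMod 2) := by
  decide

theorem star_cubeU (d : ℕ) (j : Fin d) : star (cubeU d j) = cubeU d j := by
  rw [cubeU, GroupCStar.star_of, ← map_inv, inv_ofAdd_one_zmod_two]

theorem star_prismV (k : ℕ) : star (prismV k) = prismV k := by
  rw [prismV, GroupCStar.star_of, ← map_inv, inv_ofAdd_one_zmod_two]

theorem prismW_pow_self (k : ℕ) : prismW k ^ k = 1 := by
  rw [prismW, ← GroupCStar.of_pow, ← map_pow, ← ofAdd_nsmul, nsmul_one, ZMod.natCast_self,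
    ofAdd_zero, map_one, GroupCStar.of_one]

theorem star_prismW_mul_self (k : ℕ) : star (prismW k) * prismW k = 1 := by
  rw [prismW, GroupCStar.star_of, ← GroupCStar.of_mul, inv_mul_cancel, GroupCStar.of_one]

/-- The noncommutative `d`-cube `NC(d) = Span{1, u_1, …, u_d} ⊆ C⋆(ℤ₂ * ⋯ * ℤ₂)`. -/
def NC (d : ℕ) : OperatorSubsystem (GroupCStar (CubeGroup d)) where
  toSubmodule := Submodule.span ℂ ({1} ∪ Set.range (cubeU d))
  one_mem := Submodule.subset_span (Or.inl rfl)
  star_mem := by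
    refine star_mem_span_of_star_mem ?_
    rintro a (rfl | ⟨j, rfl⟩)
    · rw [star_one]; exact Submodule.subset_span (Or.inl rfl)
    · rw [star_cubeU]; exact Submodule.subset_span (Or.inr ⟨j, rfl⟩)

theorem star_prismW_pow (k i : ℕ) (hi : i ≤ k) :
    star (prismW k ^ i) = prismW k ^ (k - i) := by
  have h : star (prismW k ^ i) * prismW k ^ i = 1 := by
    rw [star_pow]
    induction i with
    | zero => simp
    | succ i ih =>
      rw [pow_succ, pow_succ', mul_assoc, ← mul_assoc _ (prismW k), star_prismW_mul_self, one_mul,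
        ih (by omega)]
  calc star (prismW k ^ i) = star (prismW k ^ i) * (prismW k ^ i * prismW k ^ (k - i)) := by
        rw [← pow_add, Nat.add_sub_cancel' hi, prismW_pow_self, mul_one]
    _ = _ := by rw [← mul_assoc, h, one_mul]

/-- The noncommutative `k`-prism `NCP(k) = Span{1, w, w², …, w^{k-1}, v} ⊆ C⋆(ℤ_k * ℤ₂)`. -/
def NCP (k : ℕ) : OperatorSubsystem (GroupCStar (PrismGroup k)) where
  toSubmodule := Submodule.span ℂ ({1, prismV k} ∪ {a | ∃ i < k, a = prismW k ^ i})
  one_mem := Submodule.subset_span (Or.inl (Or.inl rfl))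
  star_mem := by
    refine star_mem_span_of_star_mem ?_
    rintro a ((rfl | rfl) | ⟨i, hi, rfl⟩)
    · rw [star_one]; exact Submodule.subset_span (Or.inl (Or.inl rfl))
    · rw [star_prismV]; exact Submodule.subset_span (Or.inl (Or.inr rfl))
    · rw [star_prismW_pow k i hi.le]
      rcases Nat.eq_zero_or_pos i with rfl | hi0
      · rw [Nat.sub_zero, prismW_pow_self]
        exact Submodule.subset_span (Or.inl (Or.inl rfl))
      · exact Submodule.subset_span (Or.inr ⟨k - i, by omega, rfl⟩)

end NoncommutativeCubesAndPrisms

end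

/-!
The argument treats both systems at once. Let `S` be the span of the powers of finitely many
unitaries `w_j` with `w_j ^ k_j = 1` that are universal with these relations
(`IsFreeRootSystem`), and let `p_{j,i}` be the spectral projections of `w_j`, so that
`∑ᵢ p_{j,i} = 1` for every `j`. For `NC(d)` the `w_j` are the `u_j`, and for `NCP(k)` they are `w`
and `v`.

The crucial fact is `IsFreeRootSystem.generatesMatCones`: for a positive matrix `M` over `S` and
`ε > 0`, the matrix `ε + M` is a sum `∑ C_{j,i} ⊗ p_{j,i}` with positive semidefinite scalar
matrices `C_{j,i}`. Otherwise the M. Riesz extension theorem gives a functional `G` on `M_n(S)`,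
nonnegative on all such sums, with `G 1 = 1` and `G (ε + M) ≤ 0`, so that `G M < 0`. The matrices
`X_{j,i} = [G (E_{ab} ⊗ p_{j,i})]` are positive semidefinite, and `∑ᵢ X_{j,i}` does not depend
on `j`. Factor `X_{j,i} = B⋆ B`; for each `j`, the columns of these factors, collected into one
Hilbert space, form a family of vectors with Gram matrix `∑ᵢ X_{j,i}`. Families with the same Gram
matrix differ by a unitary, so that all the `p_{j,i}` can be realized on one Hilbert space, with one
family of vectors `ξ_a` such that `G (E_{ab} ⊗ x) = ⟪ξ_a, π(x) ξ_b⟫` (`exists_dilation`,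
`IsFreeRootSystem.exists_rep`). The universal property makes `π` a representation, and then
`G M = ∑ ⟪ξ_a, π(M_{ab}) ξ_b⟫ ≥ 0`, a contradiction.

Everything else follows from this decomposition (`GeneratesMatCones`). A linear map with positive
values at the `p_{j,i}` is completely positive, since `C ⊗ p` with `C ≥ 0` and `p ≥ 0` is a sum of
congruences of `p`; this is the OMAX property. In particular `[f_{ab}] ∈ M_n(S^δ)` is positive as
soon as the scalar matrices `[f_{ab}(p_{j,i})]` are positive semidefinite. Hence a faithful state
is an Archimedean matrix order unit, and the OMIN property reduces to the complete positivity of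
positive functionals. The functional with the value `1 / k_j` at `p_{j,i}` is a faithful state.
-/

open MatrixOrderedSpace

/-! ### Scalar matrices, separation and unitary equivalence -/

open scoped MatrixOrder in
theorem exists_conjTranspose_mul {n : ℕ} {C : Matrix (Fin n) (Fin n) ℂ} (hC : C.PosSemidef) :
    ∃ B : Matrix (Fin n) (Fin n) ℂ, C = Bᴴ * B := by
  obtain ⟨B, hB⟩ := CStarAlgebra.nonneg_iff_eq_star_mul_self.1 (Matrix.nonneg_iff_posSemidef.2 hC)
  exact ⟨B, hB⟩

/-- Algebraic separation: a Hermitian element `x` outside a convex cone `K` of Hermitian elements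
with order unit `e` is separated from `K` by a complex linear functional. -/
theorem exists_positive_functional {E : Type*} [AddCommGroup E] [Module ℂ E] [StarAddMonoid E]
    [StarModule ℂ E] (K : Set E) (hzero : 0 ∈ K) (hadd : ∀ y ∈ K, ∀ z ∈ K, y + z ∈ K)
    (hsmul : ∀ r : ℝ, 0 ≤ r → ∀ y ∈ K, (r : ℂ) • y ∈ K) (hsa : ∀ y ∈ K, star y = y)
    (e : E) (he : e ∈ K) (hord : ∀ y : E, star y = y → ∃ r : ℝ, (r : ℂ) • e + y ∈ K) (x : E)
    (hx : star x = x) (hxK : x ∉ K) :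
    ∃ G : E →ₗ[ℂ] ℂ, (∀ y ∈ K, 0 ≤ G y) ∧ G x ≤ 0 ∧ G e = 1 := by
  have hsm : ∀ (r : ℝ), 0 ≤ r → ∀ y ∈ K, r • y ∈ K := fun r hr y hy => by
    rw [← Complex.coe_smul]; exact hsmul r hr y hy
  simp only [Complex.coe_smul] at hord
  have hsm' : ∀ (r : ℝ) (y : E), 0 < r → r • y ∈ K → y ∈ K := fun r y hr hy => by
    have := hsm r⁻¹ (inv_pos.2 hr).le _ hy
    rwa [smul_smul, inv_mul_cancel₀ hr.ne', one_smul] at this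
  have hne : -e ∉ K := fun h => by
    obtain ⟨r, hr⟩ := hord x hx
    apply hxK
    have h2 := hadd _ hr _ (hadd _ (hsm |r| (abs_nonneg r) _ h) _
      (hsm (|r| - r) (by linarith [le_abs_self r]) _ he))
    convert h2 using 1
    module
  have he0 : e ≠ 0 := fun h => hne (by rw [h, neg_zero]; exact hzero)
  have hstar : ∀ (r : ℝ) (y : E), star (r • y) = r • star y := fun r y => by
    rw [← Complex.coe_smul, star_smul, Complex.star_def, Complex.conj_ofReal, Complex.coe_smul]
  -- The Riesz extension theorem is applied to the cone of all `y` whose real part lies in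
  -- `K - ℝ₊ x`: it contains the skew-adjoint elements, so that a functional nonnegative on it
  -- vanishes there.
  let K' : PointedCone ℝ E :=
    { carrier := {y | ∃ κ ∈ K, ∃ c : ℝ, 0 ≤ c ∧ y + star y = κ - c • x}
      add_mem' := by
        rintro y z ⟨κ, hκ, c, hc, h⟩ ⟨κ', hκ', c', hc', h'⟩
        refine ⟨κ + κ', hadd _ hκ _ hκ', c + c', add_nonneg hc hc', ?_⟩
        rw [star_add, add_add_add_comm, h, h']
        module
      zero_mem' := ⟨0, hzero, 0, le_rfl, by simp⟩
      smul_mem' := by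
        rintro ⟨r, hr⟩ y ⟨κ, hκ, c, hc, h⟩
        refine ⟨r • κ, hsm r hr κ hκ, r * c, mul_nonneg hr hc, ?_⟩
        change r • y + star (r • y) = _
        rw [hstar, ← smul_add, h]
        module }
  have hmem : ∀ y, y ∈ K' ↔ ∃ κ ∈ K, ∃ c : ℝ, 0 ≤ c ∧ y + star y = κ - c • x := fun y => Iff.rfl
  obtain ⟨g, hg1, hg2⟩ := riesz_extension K' (LinearPMap.mkSpanSingleton e (1 : ℝ) he0) (by
      rintro ⟨y, hy⟩ hyK
      obtain ⟨a, rfl⟩ := Submodule.mem_span_singleton.1 hy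
      erw [LinearPMap.mkSpanSingleton'_apply]
      rw [RingHom.id_apply, smul_eq_mul, mul_one]
      by_contra! ha
      obtain ⟨κ, hκ, c, hc, h⟩ := (hmem _).1 hyK
      rw [hstar, hsa e he, eq_sub_iff_add_eq] at h
      have hκe : κ = (2 * a) • e + c • x := by rw [← h]; module
      rcases hc.eq_or_lt with rfl | hc
      · apply hne
        apply hsm' (-(2 * a)) _ (by linarith)
        convert hκ using 1
        rw [hκe]
        module
      · apply hxK
        apply hsm' c _ hc
        have := hadd _ hκ _ (hsm (-(2 * a)) (by linarith) _ he)
        convert this using 1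
        rw [hκe]
        module) (by
      intro y
      obtain ⟨r, hr⟩ := hord (y + star y) (by rw [star_add, star_star, add_comm])
      refine ⟨⟨(r / 2) • e, Submodule.mem_span_singleton.2 ⟨_, rfl⟩⟩,
        (hmem _).2 ⟨_, hr, 0, le_rfl, ?_⟩⟩
      rw [star_add, hstar, hsa e he]
      module)
  have hge : g e = 1 := by
    have := hg1 ⟨e, Submodule.mem_span_singleton_self e⟩
    rw [this]
    exact LinearPMap.mkSpanSingleton_apply ℝ ℝ he0 1
  have hskew : ∀ y, star y = y → g (Complex.I • y) = 0 := fun y hy => by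
    have h1 : star (Complex.I • y) = -(Complex.I • y) := by simp [star_smul, hy]
    apply le_antisymm
    · have := hg2 (-(Complex.I • y)) ((hmem _).2 ⟨0, hzero, 0, le_rfl, by
        rw [star_neg, h1]; simp⟩)
      rw [map_neg] at this
      linarith
    · exact hg2 _ ((hmem _).2 ⟨0, hzero, 0, le_rfl, by rw [h1]; simp⟩)
  -- The complexification agrees with `g` on Hermitian elements, where `g (i y) = 0`.
  have hG : ∀ y, star y = y → Module.Dual.extendRCLike (𝕜 := ℂ) g y = (g y : ℂ) := fun y hy => by
    rw [Module.Dual.extendRCLike_apply]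
    have := hskew y hy
    simp only [RCLike.I_to_complex] 
    rw [this]; simp
  refine ⟨Module.Dual.extendRCLike g, fun y hy => ?_, ?_, ?_⟩
  · rw [hG y (hsa y hy)]
    have := hg2 y ((hmem _).2 ⟨(2 : ℝ) • y, hsm 2 (by norm_num) y hy, 0, le_rfl, by
      rw [hsa y hy]; module⟩)
    exact_mod_cast this
  · rw [hG x hx]
    have := hg2 (-x) ((hmem _).2 ⟨0, hzero, 2, by norm_num, by rw [star_neg, hx]; module⟩)
    rw [map_neg] at this
    have h2 : g x ≤ 0 := by linarith
    exact_mod_cast h2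
  · rw [hG e (hsa e he), hge]; norm_num

/-- Two families of vectors with the same Gram matrix differ by a unitary. -/
theorem exists_unitary_map_eq_of_inner_eq {H : Type*} [NormedAddCommGroup H] [InnerProductSpace ℂ H]
    [FiniteDimensional ℂ H] {ι : Type*} [Fintype ι] (ξ η : ι → H)
    (h : ∀ a b, inner ℂ (ξ a) (ξ b) = inner ℂ (η a) (η b)) :
    ∃ U : H ≃ₗᵢ[ℂ] H, ∀ a, U (ξ a) = η a := by
  let T : (ι → ℂ) →ₗ[ℂ] H := Fintype.linearCombination ℂ ξ
  let T' : (ι → ℂ) →ₗ[ℂ] H := Fintype.linearCombination ℂ η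
  have hin : ∀ c, ‖T c‖ = ‖T' c‖ := fun c => by
    have : inner ℂ (T c) (T c) = inner ℂ (T' c) (T' c) := by
      simp only [T, T', Fintype.linearCombination_apply, sum_inner, inner_sum, inner_smul_left,
        inner_smul_right, h]
    rw [inner_self_eq_norm_sq_to_K, inner_self_eq_norm_sq_to_K] at this
    exact (sq_eq_sq₀ (norm_nonneg _) (norm_nonneg _)).1 (by exact_mod_cast this)
  have hker : LinearMap.ker T ≤ LinearMap.ker T' := fun c hc => by
    rw [LinearMap.mem_ker] at *
    rw [← norm_eq_zero, ← hin, hc, norm_zero]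
  let L : LinearMap.range T →ₗ[ℂ] H :=
    (Submodule.liftQ _ T' hker).comp T.quotKerEquivRange.symm.toLinearMap
  have hL : ∀ c, L ⟨T c, LinearMap.mem_range_self T c⟩ = T' c := fun c => by
    have : T.quotKerEquivRange.symm ⟨T c, LinearMap.mem_range_self T c⟩ =
        Submodule.Quotient.mk c := by
      rw [LinearEquiv.symm_apply_eq]; rfl
    simp only [L, LinearMap.comp_apply, LinearEquiv.coe_coe, this]
    rfl
  let L' : LinearMap.range T →ₗᵢ[ℂ] H := ⟨L, by
    rintro ⟨_, c, rfl⟩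
    rw [hL, ← hin]; rfl⟩
  refine ⟨L'.extend.toLinearIsometryEquiv rfl, fun a => ?_⟩
  classical
  have hT : T (Pi.single a 1) = ξ a := by simp [T, Fintype.linearCombination_apply_single]
  have hT' : T' (Pi.single a 1) = η a := by simp [T', Fintype.linearCombination_apply_single]
  rw [LinearIsometry.coe_toLinearIsometryEquiv, ← hT, ← hT', ← hL]
  exact L'.extend_apply ⟨T (Pi.single a 1), _⟩

/-! ### Spectral projections of unitaries of finite order -/

section SpectralProjection

/-- The spectral projection `(1/k) ∑_{a < k} (z⁻¹ w)^a` of an element `w` with `w ^ k = 1` at the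
`k`-th root of unity `z`. -/
noncomputable def rootProj {A : Type*} [Ring A] [Algebra ℂ A] (k : ℕ) (w : A) (z : ℂ) : A :=
  (k : ℂ)⁻¹ • ∑ a ∈ Finset.range k, (z⁻¹ • w) ^ a

variable {A : Type*} [Ring A] [Algebra ℂ A] {k : ℕ} {w : A}

theorem mul_rootProj (hk : w ^ k = 1) {z : ℂ} (hz : z ^ k = 1) (hz0 : z ≠ 0) :
    w * rootProj k w z = z • rootProj k w z := by
  have h1 : (z⁻¹ • w) * ∑ a ∈ Finset.range k, (z⁻¹ • w) ^ a =
      ∑ a ∈ Finset.range k, (z⁻¹ • w) ^ a := by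
    rw [← sub_eq_zero, ← sub_one_mul, mul_geom_sum, smul_pow, hk, inv_pow, hz, inv_one, one_smul,
      sub_self]
  have h2 : (z⁻¹ • w) * rootProj k w z = rootProj k w z := by
    rw [rootProj, mul_smul_comm, h1]
  nth_rewrite 2 [← h2]
  rw [smul_mul_assoc, smul_smul, mul_inv_cancel₀ hz0, one_smul]

theorem pow_mul_rootProj (hk : w ^ k = 1) {z : ℂ} (hz : z ^ k = 1) (hz0 : z ≠ 0) (m : ℕ) :
    w ^ m * rootProj k w z = z ^ m • rootProj k w z := by
  induction m with
  | zero => simp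
  | succ m ih => rw [pow_succ, mul_assoc, mul_rootProj hk hz hz0, mul_smul_comm, ih, smul_smul,
      ← pow_succ']

theorem sum_rootProj {ζ : ℂ} (hζ : IsPrimitiveRoot ζ k) (hk0 : k ≠ 0) :
    ∑ i : Fin k, rootProj k w (ζ ^ (i : ℕ)) = 1 := by
  have h0 : ζ ≠ 0 := hζ.ne_zero hk0
  have hk0' : (k : ℂ) ≠ 0 := by exact_mod_cast hk0
  rw [Fin.sum_univ_eq_sum_range (fun i => rootProj k w (ζ ^ i))]
  simp only [rootProj]
  rw [← Finset.smul_sum, Finset.sum_comm, Finset.sum_eq_single_of_mem 0 (by simp; omega)]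
  · simp [← Nat.cast_smul_eq_nsmul ℂ, smul_smul, hk0']
  · intro a ha ha0
    have h1 : ∀ i, ((ζ ^ i)⁻¹ • w) ^ a = ((ζ⁻¹ ^ a) ^ i) • w ^ a := fun i => by
      rw [smul_pow, ← inv_pow, ← pow_mul, ← pow_mul, mul_comm]
    simp only [h1]
    rw [← Finset.sum_smul]
    have h2 : ζ⁻¹ ^ a ≠ 1 := (hζ.inv).pow_ne_one_of_pos_of_lt ha0 (Finset.mem_range.1 ha)
    have h3 : ∑ i ∈ Finset.range k, (ζ⁻¹ ^ a) ^ i = 0 := by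
      rw [geom_sum_eq h2, ← pow_mul, mul_comm, pow_mul, hζ.inv.pow_eq_one]
      simp
    rw [h3, zero_smul]

theorem pow_eq_sum_rootProj {ζ : ℂ} (hζ : IsPrimitiveRoot ζ k) (hk0 : k ≠ 0) (hk : w ^ k = 1)
    (m : ℕ) : w ^ m = ∑ i : Fin k, (ζ ^ (i : ℕ)) ^ m • rootProj k w (ζ ^ (i : ℕ)) := by
  conv_lhs => rw [← mul_one (w ^ m), ← sum_rootProj (w := w) hζ hk0, Finset.mul_sum]
  refine Finset.sum_congr rfl fun i _ => pow_mul_rootProj hk ?_ (pow_ne_zero _ (hζ.ne_zero hk0)) m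
  rw [← pow_mul, mul_comm, pow_mul, hζ.pow_eq_one, one_pow]

/-- The spectral projection is positive, since `p⋆ p = p`. -/
theorem star_mul_self_rootProj [StarRing A] [StarModule ℂ A] (hk0 : k ≠ 0) (hw : star w * w = 1)
    (hk : w ^ k = 1) {z : ℂ} (hz : z ^ k = 1) :
    star (rootProj k w z) * rootProj k w z = rootProj k w z := by
  have hn : ‖z‖ = 1 := Complex.norm_eq_one_of_pow_eq_one hz hk0
  have hz0 : z ≠ 0 := norm_ne_zero_iff.1 (by rw [hn]; norm_num)
  have hk0' : (k : ℂ) ≠ 0 := by exact_mod_cast hk0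
  have h1 : star (z⁻¹ • w) * rootProj k w z = rootProj k w z := by
    have h2 : (z⁻¹ • w) * rootProj k w z = rootProj k w z := by
      rw [smul_mul_assoc, mul_rootProj hk hz hz0, smul_smul, inv_mul_cancel₀ hz0, one_smul]
    have h3 : star (z⁻¹ • w) * (z⁻¹ • w) = 1 := by
      rw [star_smul, smul_mul_smul_comm, hw, Complex.star_def, ← Complex.normSq_eq_conj_mul_self,
        Complex.normSq_eq_norm_sq, norm_inv, hn]
      simp
    nth_rewrite 1 [← h2]
    rw [← mul_assoc, h3, one_mul]
  have h4 : ∀ a : ℕ, star (z⁻¹ • w) ^ a * rootProj k w z = rootProj k w z := fun a => by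
    induction a with
    | zero => simp
    | succ a ih => rw [pow_succ, mul_assoc, h1, ih]
  nth_rewrite 1 [rootProj]
  rw [star_smul, star_sum, smul_mul_assoc, Finset.sum_mul]
  simp only [star_pow, h4]
  simp [← Nat.cast_smul_eq_nsmul ℂ, smul_smul, hk0']

end SpectralProjection

/-! ### Dilation to unitaries of finite order -/

/-- The diagonal unitary with given `k`-th roots of unity on the diagonal. -/
theorem exists_unitary_of_root_of_one {ι : Type*} [Fintype ι] [DecidableEq ι] {k : ℕ} (hk : k ≠ 0)
    (d : ι → ℂ) (hd : ∀ s, d s ^ k = 1) :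
    ∃ D : unitary (EuclideanSpace ℂ ι →L[ℂ] EuclideanSpace ℂ ι), D ^ k = 1 ∧
      ∀ (m : ℕ) (v : EuclideanSpace ℂ ι) (s : ι),
        ((D ^ m : unitary (EuclideanSpace ℂ ι →L[ℂ] EuclideanSpace ℂ ι)) :
          EuclideanSpace ℂ ι →L[ℂ] EuclideanSpace ℂ ι) v s = d s ^ m * v s := by
  have hn : ∀ s, star (d s) * d s = 1 := fun s => by
    rw [Complex.star_def, ← Complex.normSq_eq_conj_mul_self, Complex.normSq_eq_norm_sq,
      Complex.norm_eq_one_of_pow_eq_one (hd s) hk]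
    simp
  have hu : Matrix.diagonal d ∈ unitary (Matrix ι ι ℂ) := by
    rw [Unitary.mem_iff, Matrix.star_eq_conjTranspose, Matrix.diagonal_conjTranspose,
      Matrix.diagonal_mul_diagonal, Matrix.diagonal_mul_diagonal]
    have h1 : (fun s => star d s * d s) = fun _ => 1 := funext hn
    have h2 : (fun s => d s * star d s) = fun _ => 1 := funext fun s => by
      rw [mul_comm]; exact hn s
    rw [h1, h2]
    exact ⟨Matrix.diagonal_one, Matrix.diagonal_one⟩
  refine ⟨⟨Matrix.toEuclideanCLM (𝕜 := ℂ) (n := ι) (Matrix.diagonal d),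
    Unitary.map_mem (Matrix.toEuclideanCLM (𝕜 := ℂ) (n := ι)) hu⟩, ?_, fun m v s => ?_⟩
  · ext1
    simp only [SubmonoidClass.mk_pow, OneMemClass.coe_one]
    rw [← map_pow, Matrix.diagonal_pow]
    have : d ^ k = fun _ => 1 := funext hd
    rw [this, Matrix.diagonal_one, map_one]
  · simp only [SubmonoidClass.mk_pow]
    rw [← map_pow, Matrix.diagonal_pow]
    simp [Matrix.mulVec_diagonal]

/-- Simultaneous dilation: positive semidefinite matrices `X_{j,i}` whose sums over `i` do not
depend on `j` are compressions, to one family of vectors `ξ_a`, of the spectral projections of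
unitaries `W_j` with `W_j ^ k_j = 1`. The conclusion is stated in terms of the powers of `W_j`. -/
theorem exists_dilation {J : Type} [Fintype J] [DecidableEq J] [Nonempty J] (k : J → ℕ)
    (hk : ∀ j, k j ≠ 0) (ζ : J → ℂ) (hζ : ∀ j, ζ j ^ k j = 1) {n : ℕ}
    (X : (Σ j, Fin (k j)) → Matrix (Fin n) (Fin n) ℂ) (hX : ∀ s, (X s).PosSemidef)
    (X₀ : Matrix (Fin n) (Fin n) ℂ) (hX₀ : ∀ j, ∑ i, X ⟨j, i⟩ = X₀) :
    ∃ (H : Type) (_ : NormedAddCommGroup H) (_ : InnerProductSpace ℂ H) (_ : CompleteSpace H)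
      (ξ : Fin n → H) (W : J → unitary (H →L[ℂ] H)), (∀ j, W j ^ k j = 1) ∧
      ∀ (j : J) (m : ℕ) (a b : Fin n),
        inner ℂ (ξ a) (((W j ^ m : unitary (H →L[ℂ] H)) : H →L[ℂ] H) (ξ b)) =
          ∑ i : Fin (k j), (ζ j ^ (i : ℕ)) ^ m * X ⟨j, i⟩ a b := by
  choose B hB using fun s => exists_conjTranspose_mul (hX s)
  let ι := (Σ j, Fin (k j)) × Fin n
  let H := EuclideanSpace ℂ ι
  -- For fixed `j`, the vectors `η j a` have Gram matrix `X₀`, and the diagonal unitary `D j` with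
  -- the entries `ζ_j ^ i` has the required matrix coefficients at them. Away from the `j`-th block
  -- the diagonal entries are irrelevant.
  let η : J → Fin n → H := fun j a =>
    WithLp.toLp 2 fun t => if t.1.1 = j then B t.1 t.2 a else 0
  let d : J → ι → ℂ := fun j t => if t.1.1 = j then ζ j ^ (t.1.2 : ℕ) else 1
  have hd : ∀ j t, d j t ^ k j = 1 := fun j t => by
    simp only [d]
    split_ifs
    · rw [← pow_mul, mul_comm, pow_mul, hζ, one_pow]
    · rw [one_pow]
  choose D hD1 hD2 using fun j => exists_unitary_of_root_of_one (hk j) (d j) (hd j)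
  have hin : ∀ j m a b, inner ℂ (η j a) (((D j ^ m : unitary (H →L[ℂ] H)) : H →L[ℂ] H) (η j b)) =
      ∑ i : Fin (k j), (ζ j ^ (i : ℕ)) ^ m * X ⟨j, i⟩ a b := fun j m a b => by
    rw [PiLp.inner_apply]
    simp only [hD2]
    simp only [ι, Fintype.sum_prod_type, Fintype.sum_sigma]
    rw [Finset.sum_eq_single_of_mem j (Finset.mem_univ j)]
    · refine Finset.sum_congr rfl fun i _ => ?_
      rw [hB, Matrix.mul_apply, Finset.mul_sum]
      refine Finset.sum_congr rfl fun c _ => ?_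
      simp [η, d, Matrix.conjTranspose_apply]
      ring
    · intro j' _ hj
      refine Finset.sum_eq_zero fun i _ => Finset.sum_eq_zero fun c _ => ?_
      simp [η, hj]
  have hη : ∀ j a b, inner ℂ (η j a) (η j b) = X₀ a b := fun j a b => by
    have := hin j 0 a b
    simp only [pow_zero, one_mul] at this
    rw [← hX₀ j, Matrix.sum_apply, ← this]
    rfl
  obtain ⟨j₀⟩ := ‹Nonempty J›
  -- Conjugation by the unitaries `U j : η j₀ a ↦ η j a` moves all these families to `η j₀`.
  choose U hU using fun j => exists_unitary_map_eq_of_inner_eq (η j₀) (η j)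
    (fun a b => by rw [hη, hη])
  let U' : J → unitary (H →L[ℂ] H) := fun j => Unitary.linearIsometryEquiv.symm (U j)
  refine ⟨H, inferInstance, inferInstance, inferInstance, η j₀,
    fun j => (U' j)⁻¹ * D j * U' j, fun j => ?_, fun j m a b => ?_⟩
  · have := conj_pow (i := k j) (a := (U' j)⁻¹) (b := D j)
    rw [inv_inv] at this
    rw [this, hD1, mul_one, inv_mul_cancel]
  · have := conj_pow (i := m) (a := (U' j)⁻¹) (b := D j)
    rw [inv_inv] at this
    rw [this, ← hin]
    have hUa : ∀ a, (U' j : H →L[ℂ] H) (η j₀ a) = η j a := fun a => hU j a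
    have : (((U' j)⁻¹ * D j ^ m * U' j : unitary (H →L[ℂ] H)) : H →L[ℂ] H) (η j₀ b) =
        (star (U' j : H →L[ℂ] H)) (((D j ^ m : unitary (H →L[ℂ] H)) : H →L[ℂ] H) (η j b)) := by
      rw [← hUa b]; rfl
    rw [this, ContinuousLinearMap.star_eq_adjoint, ContinuousLinearMap.adjoint_inner_right, hUa]

/-! ### Elementary tensors with scalar matrices -/

section ScalarTensor

variable {V : Type*} [AddCommGroup V] [Module ℂ V]

/-- The elementary tensor `C ⊗ x ∈ M_n(ℂ) ⊗ V = M_n(V)`. -/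
def matTensor {n : ℕ} (C : Matrix (Fin n) (Fin n) ℂ) (x : V) : Matrix (Fin n) (Fin n) V :=
  C.map fun c => c • x

theorem matTensor_apply {n : ℕ} (C : Matrix (Fin n) (Fin n) ℂ) (x : V) (i j : Fin n) :
    matTensor C x i j = C i j • x := rfl

theorem matTensor_add {n : ℕ} (C D : Matrix (Fin n) (Fin n) ℂ) (x : V) :
    matTensor (C + D) x = matTensor C x + matTensor D x := by
  ext i j; exact add_smul _ _ _

theorem matTensor_smul {n : ℕ} (c : ℂ) (C : Matrix (Fin n) (Fin n) ℂ) (x : V) :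
    matTensor (c • C) x = c • matTensor C x := by
  ext i j; exact mul_smul _ _ _

theorem matTensor_zero {n : ℕ} (x : V) : matTensor (0 : Matrix (Fin n) (Fin n) ℂ) x = 0 := by
  ext i j; exact zero_smul _ _

theorem matTensor_one {n : ℕ} (x : V) :
    matTensor (1 : Matrix (Fin n) (Fin n) ℂ) x = Matrix.diagonal fun _ => x := by
  ext i j
  by_cases h : i = j
  · subst h; simp [matTensor_apply]
  · simp [matTensor_apply, h]

theorem matTensor_sum_right {n : ℕ} {ι : Type*} (t : Finset ι) (C : Matrix (Fin n) (Fin n) ℂ)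
    (x : ι → V) : matTensor C (∑ s ∈ t, x s) = ∑ s ∈ t, matTensor C (x s) := by
  ext i j; simp [matTensor_apply, Matrix.sum_apply, Finset.smul_sum]

theorem map_sum_matTensor {W : Type*} [AddCommGroup W] [Module ℂ W] (φ : V →ₗ[ℂ] W) {n : ℕ}
    {ι : Type*} (t : Finset ι) (C : ι → Matrix (Fin n) (Fin n) ℂ) (x : ι → V) :
    (∑ s ∈ t, matTensor (C s) (x s)).map φ = ∑ s ∈ t, matTensor (C s) (φ (x s)) := by
  ext i j; simp [matTensor_apply, Matrix.sum_apply]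

variable [StarAddMonoid V] [StarModule ℂ V]

theorem star_matTensor {n : ℕ} (C : Matrix (Fin n) (Fin n) ℂ) {x : V} (hx : star x = x) :
    star (matTensor C x) = matTensor Cᴴ x := by
  ext i j
  simp [Matrix.star_apply, matTensor_apply, hx]

variable [MatrixOrderedSpace V]

theorem sum_mem_matCone {n : ℕ} {ι : Type*} (t : Finset ι) (M : ι → Matrix (Fin n) (Fin n) V)
    (h : ∀ s ∈ t, M s ∈ matCone n) : ∑ s ∈ t, M s ∈ matCone n := by
  classical
  induction t using Finset.induction_on with
  | empty => exact zero_mem n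
  | insert a t ha ih =>
    rw [Finset.sum_insert ha]
    exact add_mem (h a (Finset.mem_insert_self a t))
      (ih fun s hs => h s (Finset.mem_insert_of_mem hs))

/-- Writing `C = B⋆ B`, the tensor `C ⊗ x` is the sum over the rows `b` of `B` of the congruences
`b⋆ x b`. -/
theorem matTensor_mem_matCone {n : ℕ} {C : Matrix (Fin n) (Fin n) ℂ} (hC : C.PosSemidef) {x : V}
    (hx : OSDual.oneByOne x ∈ matCone 1) :
    matTensor C x ∈ matCone n := by
  obtain ⟨B, rfl⟩ := exists_conjTranspose_mul hC
  have : matTensor (Bᴴ * B) x = ∑ c, scalarCongr (Matrix.of fun (_ : Fin 1) j => B c j)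
      (OSDual.oneByOne x) := by
    ext i j
    simp [OSDual.oneByOne, matTensor_apply, Matrix.mul_apply, Matrix.sum_apply, scalarCongr,
      Finset.sum_smul]
  rw [this]
  exact sum_mem_matCone _ _ fun c _ => scalarCongr_mem _ hx

end ScalarTensor

/-! ### The matrix algebra as an operator system -/

section MatrixUnit

open scoped MatrixOrder Matrix.Norms.L2Operator in
theorem exists_pos_smul_one_add_posSemidef {ι : Type*} [Fintype ι] [DecidableEq ι]
    {N : Matrix ι ι ℂ} (hN : N.IsHermitian) :
    ∃ r : ℝ, 0 < r ∧ ((r : ℂ) • (1 : Matrix ι ι ℂ) + N).PosSemidef := by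
  obtain ⟨r, hr, h⟩ := OperatorSubsystem.exists_nonneg_smul_one_add N hN
  exact ⟨r, hr, Matrix.nonneg_iff_posSemidef.1 h⟩

open scoped MatrixOrder Matrix.Norms.L2Operator in
theorem posSemidef_of_forall_pos_smul_one_add {ι : Type*} [Fintype ι] [DecidableEq ι]
    {N : Matrix ι ι ℂ} (hN : ∀ r : ℝ, 0 < r → ((r : ℂ) • (1 : Matrix ι ι ℂ) + N).PosSemidef) :
    N.PosSemidef :=
  Matrix.nonneg_iff_posSemidef.1
    (OperatorSubsystem.nonneg_of_forall N fun r hr => Matrix.nonneg_iff_posSemidef.2 (hN r hr))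

theorem isArchimedeanMatrixOrderUnit_one_matrix (q : ℕ) :
    IsArchimedeanMatrixOrderUnit (1 : Matrix (Fin q) (Fin q) ℂ) := by
  have hc : ∀ (n : ℕ) (r : ℝ) (M : Matrix (Fin n) (Fin n) (Matrix (Fin q) (Fin q) ℂ)),
      Matrix.comp _ _ _ _ ℂ ((r : ℂ) • Matrix.diagonal (fun _ => 1) + M) =
        (r : ℂ) • 1 + Matrix.comp _ _ _ _ ℂ M := fun n r M => by
    ext ⟨i, a⟩ ⟨j, b⟩
    by_cases hij : i = j
    · subst hij
      by_cases hab : a = b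
      · subst hab; simp
      · simp [hab]
    · simp [hij]
  refine ⟨star_one _, fun n => ⟨fun M hM => ?_, fun M hM => ?_⟩⟩
  · obtain ⟨r, hr, h⟩ := exists_pos_smul_one_add_posSemidef (N := Matrix.comp _ _ _ _ ℂ M) (by
      ext ⟨i, a⟩ ⟨j, b⟩
      exact congrFun (congrFun (congrFun (congrFun hM i) j) a) b)
    exact ⟨r, hr, by rw [← hc] at h; exact h⟩
  · refine posSemidef_of_forall_pos_smul_one_add (N := Matrix.comp _ _ _ _ ℂ M) fun r hr => ?_
    rw [← hc]
    exact hM r hr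

theorem oneByOne_mem_matCone_matrix_iff {q : ℕ} {N : Matrix (Fin q) (Fin q) ℂ} :
    OSDual.oneByOne N ∈ matCone 1 ↔
      N.PosSemidef :=
  ⟨fun h => Matrix.PosSemidef.submatrix (n := Fin 1 × Fin q) h fun i => (0, i),
    fun h => h.submatrix Prod.snd⟩

end MatrixUnit

/-! ### Operator systems with a finite generating family of positive elements -/

section ConeGenerators

theorem OSDual.hat_smul_diagonal_add {V : Type*} [AddCommGroup V] [Module ℂ V] {n : ℕ} (r : ℝ)
    (f : OSDual V)
    (F : Matrix (Fin n) (Fin n) (OSDual V)) (x : V) :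
    OSDual.hat ((r : ℂ) • Matrix.diagonal (fun _ => f) + F) x =
      ((r : ℂ) * f x) • 1 + OSDual.hat F x := by
  ext i j
  rw [OSDual.hat_apply, Matrix.add_apply, OSDual.add_apply, Matrix.smul_apply, OSDual.smul_apply,
    Matrix.add_apply, OSDual.hat_apply]
  by_cases hij : i = j
  · subst hij; simp
  · simp [hij, OSDual.zero_apply]

variable {V : Type*} [AddCommGroup V] [Module ℂ V] [StarAddMonoid V] [StarModule ℂ V]
  [OperatorSystem V] {σ : Type*} [Fintype σ]

/-- Finitely many positive elements `P_s` generate the matrix cones of `V`, up to closure: each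
positive matrix becomes a sum of tensors `C_s ⊗ P_s` with positive semidefinite scalar matrices
`C_s` after an arbitrarily small multiple of the order unit is added. -/
structure GeneratesMatCones (P : σ → V) : Prop where
  mem_cone : ∀ s, OSDual.oneByOne (P s) ∈ matCone 1
  exists_eq_sum : ∀ {n : ℕ} (M : Matrix (Fin n) (Fin n) V), M ∈ matCone n → ∀ ε : ℝ, 0 < ε →
    ∃ C : σ → Matrix (Fin n) (Fin n) ℂ, (∀ s, (C s).PosSemidef) ∧
      (ε : ℂ) • Matrix.diagonal (fun _ => OperatorSystem.unit) + M = ∑ s, matTensor (C s) (P s)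

namespace GeneratesMatCones

variable {P : σ → V}

/-- Complete positivity needs to be tested at the generators only. -/
theorem isCompletelyPositiveMap (hP : GeneratesMatCones P) {W : Type*} [AddCommGroup W]
    [Module ℂ W] [StarAddMonoid W] [StarModule ℂ W] [MatrixOrderedSpace W] {u : W}
    (hu : IsArchimedeanMatrixOrderUnit u) (φ : V →ₗ[ℂ] W)
    (hφ : ∀ s, OSDual.oneByOne (φ (P s)) ∈ matCone 1) :
    IsCompletelyPositiveMap φ := by
  intro n M hM
  have key : ∀ (N : Matrix (Fin n) (Fin n) V), N ∈ matCone n → ∀ ε : ℝ, 0 < ε →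
      (ε : ℂ) • Matrix.diagonal (fun _ => φ OperatorSystem.unit) + N.map φ ∈ matCone n := by
    intro N hN ε hε
    obtain ⟨C, hC, h⟩ := hP.exists_eq_sum N hN ε hε
    have h' := congrArg (fun X => X.map φ) h
    simp only [map_sum_matTensor] at h'
    have h2 : ((ε : ℂ) • Matrix.diagonal (fun _ => OperatorSystem.unit) + N).map φ =
        (ε : ℂ) • Matrix.diagonal (fun _ : Fin n => φ OperatorSystem.unit) + N.map φ := by
      ext i j
      by_cases hij : i = j
      · subst hij; simp [-Complex.coe_smul]
      · simp [hij, -Complex.coe_smul]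
    rw [← h2, h']
    exact sum_mem_matCone _ _ fun s _ => matTensor_mem_matCone (hC s) (hφ s)
  have h1 : Matrix.diagonal (fun _ : Fin n => φ OperatorSystem.unit) ∈ matCone n := by
    have := key 0 (zero_mem n) 1 one_pos
    rwa [Complex.ofReal_one, one_smul, Matrix.map_zero _ (map_zero φ), add_zero] at this
  -- `φ` need not be unital, but `φ 1 ≤ r₀ u`, so that the Archimedean property of `u` applies.
  obtain ⟨r₀, hr₀, h0⟩ := (hu.2 n).1 _ (isHermitian_of_mem h1).neg
  refine (hu.2 n).2 _ fun r hr => ?_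
  have h2 := add_mem (smul_mem (div_pos hr hr₀).le h0) (key M hM (r / r₀) (div_pos hr hr₀))
  convert h2 using 1
  have h3 : ((r / r₀ : ℝ) : ℂ) * (r₀ : ℂ) = r := by
    rw [← Complex.ofReal_mul, div_mul_cancel₀ _ hr₀.ne']
  rw [smul_add, smul_smul, h3, smul_neg]
  abel

theorem isOMAX.{v, w} {V : Type w} [AddCommGroup V] [Module ℂ V] [StarAddMonoid V]
    [StarModule ℂ V] [OperatorSystem V] {P : σ → V} (hP : GeneratesMatCones P) :
    IsOMAX.{v, w} V := fun _ _ _ _ _ _ φ hφ =>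
  hP.isCompletelyPositiveMap OperatorSystem.isArchimedeanMatrixOrderUnit_unit φ fun s =>
    hφ _ (hP.mem_cone s)

/-- A matrix of functionals is positive if and only if its values at the generators are positive
semidefinite. -/
theorem mem_matCone_dual_iff (hP : GeneratesMatCones P) {n : ℕ}
    (F : Matrix (Fin n) (Fin n) (OSDual V)) :
    F ∈ matCone n ↔ ∀ s, (OSDual.hat F (P s)).PosSemidef :=
  ⟨fun h s => oneByOne_mem_matCone_matrix_iff.1 (h 1 _ (hP.mem_cone s)),
    fun h => hP.isCompletelyPositiveMap (isArchimedeanMatrixOrderUnit_one_matrix n) _ fun s =>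
      oneByOne_mem_matCone_matrix_iff.2 (h s)⟩

/-- The map `u ↦ φ(u)(P_s)` is a positive functional, hence completely positive. -/
theorem isOMIN_dual.{v, w} {V : Type w} [AddCommGroup V] [Module ℂ V] [StarAddMonoid V]
    [StarModule ℂ V] [OperatorSystem V] {P : σ → V} (hP : GeneratesMatCones P) :
    IsOMIN.{v, w} (OSDual V) := by
  intro U _ _ _ _ _ φ hφ n M hM
  refine (hP.mem_matCone_dual_iff _).2 fun s => ?_
  refine Matrix.posSemidef_iff_dotProduct_mulVec.2 ⟨?_, fun x => ?_⟩
  · ext i j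
    have h1 := congrFun (congrFun (isHermitian_of_mem hM) i) j
    rw [Matrix.conjTranspose_apply] at h1
    have h2 := OSDual.map_star_of_isPositiveMap hφ (M j i)
    rw [Matrix.conjTranspose_apply, OSDual.hat_apply, OSDual.hat_apply, Matrix.map_apply,
      Matrix.map_apply, ← h1, h2, OSDual.star_apply, OSDual.star_eq_of_oneByOne_mem (hP.mem_cone s)]
  · have h1 := (hP.mem_matCone_dual_iff _).1 (hφ _ (scalarCongr_mem
      (Matrix.of fun i (_ : Fin 1) => x i) hM)) s
    have h2 := h1.diag_nonneg (i := 0)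
    convert h2 using 1
    rw [OSDual.hat_apply, Matrix.map_apply, scalarCongr, map_sum, OSDual.sum_apply]
    simp only [dotProduct, Matrix.mulVec, Finset.mul_sum]
    refine Finset.sum_congr rfl fun i _ => ?_
    rw [map_sum, OSDual.sum_apply]
    refine Finset.sum_congr rfl fun j _ => ?_
    rw [_root_.map_smul, OSDual.smul_apply, OSDual.hat_apply]
    simp
    ring

/-- With the test at the generators, both order unit properties concern the finitely many
matrices `r f(P_s) + [f_{ij}(P_s)]`, where `f(P_s) > 0` unless `P_s = 0`. -/
theorem isArchimedeanMatrixOrderUnit_of_isFaithfulState (hP : GeneratesMatCones P) {f : OSDual V}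
    (hf : OSDual.IsFaithfulState f) : IsArchimedeanMatrixOrderUnit f := by
  have hre : ∀ s, f (P s) = ((f (P s)).re : ℂ) := fun s =>
    Complex.eq_re_of_ofReal_le (r := 0) (by simpa using (hf.2 _ (hP.mem_cone s)).1)
  refine ⟨?_, fun n => ⟨fun F hF => ?_, fun F hF => ?_⟩⟩
  · refine OSDual.ext fun x => ?_
    obtain ⟨p, q, p', q', hp, hq, hp', hq', rfl⟩ := OSDual.exists_pos_decomp x
    have key : ∀ p : V, OSDual.oneByOne p ∈ matCone 1 → star f p = f p := fun p hp => by
      rw [OSDual.star_apply, OSDual.star_eq_of_oneByOne_mem hp]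
      exact Complex.conj_eq_iff_im.2 (Complex.le_def.1 (hf.2 p hp).1).2.symm
    have hsub : ∀ (g : OSDual V) (x y : V), g (x - y) = g x - g y := fun g x y =>
      LinearMap.map_sub g x y
    simp only [OSDual.map_add, OSDual.map_smul, hsub, key p hp, key q hq, key p' hp', key q' hq']
  · have hN : ∀ s, (OSDual.hat F (P s)).IsHermitian := fun s => by
      ext i j
      have h1 := congrFun (congrFun hF i) j
      rw [Matrix.conjTranspose_apply] at h1
      rw [Matrix.conjTranspose_apply, OSDual.hat_apply, OSDual.hat_apply, ← h1, OSDual.star_apply,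
        OSDual.star_eq_of_oneByOne_mem (hP.mem_cone s)]
    choose r hr hrN using fun s => exists_pos_smul_one_add_posSemidef (hN s)
    have hpos : ∀ s, 0 ≤ (f (P s)).re := fun s =>
      (Complex.le_def.1 (hf.2 _ (hP.mem_cone s)).1).1
    have hterm : ∀ s, 0 ≤ r s / (f (P s)).re := fun s => div_nonneg (hr s).le (hpos s)
    -- A generator with `f (P s) = 0` vanishes; its summand is the junk value `r s / 0 = 0`.
    refine ⟨1 + ∑ s, r s / (f (P s)).re, add_pos_of_pos_of_nonneg one_pos
      (Finset.sum_nonneg fun s _ => hterm s), (hP.mem_matCone_dual_iff _).2 fun s => ?_⟩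
    rw [OSDual.hat_smul_diagonal_add]
    by_cases h0 : f (P s) = 0
    · rw [(hf.2 _ (hP.mem_cone s)).2 h0, LinearMap.map_zero (OSDual.hat F), add_zero]
      rw [show f (0 : V) = 0 from LinearMap.map_zero f, mul_zero, zero_smul]
      exact Matrix.PosSemidef.zero
    · have hps : 0 < (f (P s)).re := lt_of_le_of_ne (hpos s) fun h => h0 (by
        rw [hre s, ← h, Complex.ofReal_zero])
      have hle : r s ≤ (1 + ∑ s, r s / (f (P s)).re) * (f (P s)).re := by
        have h1 := Finset.single_le_sum (fun s _ => hterm s) (Finset.mem_univ s)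
        calc r s = r s / (f (P s)).re * (f (P s)).re := by rw [div_mul_cancel₀ _ hps.ne']
          _ ≤ _ := mul_le_mul_of_nonneg_right (by linarith) hps.le
      have h2 := (Matrix.PosSemidef.one (n := Fin n) (R := ℂ)).smul
        (a := (((1 + ∑ s, r s / (f (P s)).re) * (f (P s)).re - r s : ℝ) : ℂ))
        (by exact_mod_cast sub_nonneg.2 hle)
      convert h2.add (hrN s) using 1
      rw [← add_assoc, ← add_smul, hre s]
      congr 2
      push_cast
      simp
  · refine (hP.mem_matCone_dual_iff _).2 fun s => ?_
    refine posSemidef_of_forall_pos_smul_one_add fun r hr => ?_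
    have hpos : 0 ≤ (f (P s)).re := (Complex.le_def.1 (hf.2 _ (hP.mem_cone s)).1).1
    have h1 := (hP.mem_matCone_dual_iff _).1
      (hF (r / ((f (P s)).re + 1)) (by positivity)) s
    rw [OSDual.hat_smul_diagonal_add] at h1
    have h2 := (Matrix.PosSemidef.one (n := Fin n) (R := ℂ)).smul
        (a := ((r - r / ((f (P s)).re + 1) * (f (P s)).re : ℝ) : ℂ))
        (by
          have : r - r / ((f (P s)).re + 1) * (f (P s)).re = r / ((f (P s)).re + 1) := by
            field_simp; ring
          rw [this]; exact_mod_cast (by positivity))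
    convert h2.add h1 using 1
    rw [← add_assoc, ← add_smul, hre s]
    congr 2
    push_cast
    simp

end GeneratesMatCones

end ConeGenerators

/-- Over `ℂ`, nonnegativity of the quadratic form implies that the matrix is Hermitian. -/
theorem posSemidef_of_forall_dotProduct_mulVec_nonneg {n : ℕ} {N : Matrix (Fin n) (Fin n) ℂ}
    (hN : ∀ x : Fin n → ℂ, 0 ≤ star x ⬝ᵥ N *ᵥ x) : N.PosSemidef := by
  rw [← Matrix.isPositive_toEuclideanLin_iff, LinearMap.isPositive_iff_complex]
  intro x
  have h1 : inner ℂ (Matrix.toEuclideanLin N x) x = star (star x.ofLp ⬝ᵥ N *ᵥ x.ofLp) := by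
    rw [EuclideanSpace.inner_eq_star_dotProduct, Matrix.ofLp_toLpLin, Matrix.toLin'_apply]
    rw [Matrix.star_dotProduct, star_star, dotProduct_comm]
  have h2 := Complex.le_def.1 (hN x.ofLp)
  rw [h1]
  refine ⟨?_, by simpa using h2.1⟩
  apply Complex.ext
  · simp
  · simpa using h2.2.symm

/-! ### The cone generated by elementary tensors -/

section TensorCone

variable {V : Type*} [AddCommGroup V] [Module ℂ V] {σ : Type*} [Fintype σ] {P : σ → V} {n : ℕ}

/-- The cone of the sums `∑ C_s ⊗ P_s` with positive semidefinite coefficients `C_s ∈ M_n(ℂ)`. -/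
def tensorCone (P : σ → V) (n : ℕ) : Set (Matrix (Fin n) (Fin n) V) :=
  {N | ∃ C : σ → Matrix (Fin n) (Fin n) ℂ, (∀ s, (C s).PosSemidef) ∧
    N = ∑ s, matTensor (C s) (P s)}

theorem zero_mem_tensorCone : (0 : Matrix (Fin n) (Fin n) V) ∈ tensorCone P n :=
  ⟨0, fun _ => .zero, by simp [matTensor_zero]⟩

theorem add_mem_tensorCone {y z : Matrix (Fin n) (Fin n) V} (hy : y ∈ tensorCone P n)
    (hz : z ∈ tensorCone P n) : y + z ∈ tensorCone P n := by
  obtain ⟨C, hC, rfl⟩ := hy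
  obtain ⟨D, hD, rfl⟩ := hz
  exact ⟨C + D, fun s => (hC s).add (hD s), by simp [matTensor_add, Finset.sum_add_distrib]⟩

theorem smul_mem_tensorCone {r : ℝ} (hr : 0 ≤ r) {y : Matrix (Fin n) (Fin n) V}
    (hy : y ∈ tensorCone P n) : (r : ℂ) • y ∈ tensorCone P n := by
  obtain ⟨C, hC, rfl⟩ := hy
  refine ⟨fun s => (r : ℂ) • C s, fun s => (hC s).smul (by exact_mod_cast hr), ?_⟩
  simp only [matTensor_smul, Finset.smul_sum]

theorem sum_mem_tensorCone {ι : Type*} (t : Finset ι) (f : ι → Matrix (Fin n) (Fin n) V)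
    (hf : ∀ i ∈ t, f i ∈ tensorCone P n) : ∑ i ∈ t, f i ∈ tensorCone P n :=
  Finset.sum_induction f (· ∈ tensorCone P n) (fun _ _ => add_mem_tensorCone) zero_mem_tensorCone hf

theorem matTensor_mem_tensorCone (C : Matrix (Fin n) (Fin n) ℂ) (s : σ) (hC : C.PosSemidef) :
    matTensor C (P s) ∈ tensorCone P n := by
  classical
  refine ⟨Pi.single s C, fun t => ?_, ?_⟩
  · by_cases h : t = s
    · subst h; simpa using hC
    · simpa [h] using Matrix.PosSemidef.zero
  · rw [Finset.sum_eq_single_of_mem s (Finset.mem_univ s)]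
    · simp
    · intro t _ h; simp [h, matTensor_zero]

variable [StarAddMonoid V] [StarModule ℂ V]

theorem star_eq_of_mem_tensorCone (hP : ∀ s, star (P s) = P s) {y : Matrix (Fin n) (Fin n) V}
    (hy : y ∈ tensorCone P n) : star y = y := by
  obtain ⟨C, hC, rfl⟩ := hy
  rw [star_sum]
  exact Finset.sum_congr rfl fun s _ => by rw [star_matTensor _ (hP s), (hC s).isHermitian.eq]

/-- If the `P_s` span `V` and `e` dominates each `1 ⊗ P_s`, then `e` is an order unit for the
cone of the `∑ C_s ⊗ P_s`: the coefficients of a Hermitian matrix over `V` may be chosen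
Hermitian, and these are bounded below by multiples of `1`. -/
theorem exists_smul_add_mem_tensorCone (hP : ∀ s, star (P s) = P s)
    (hspan : Submodule.span ℂ (Set.range P) = ⊤) {e : Matrix (Fin n) (Fin n) V}
    (he : ∀ s, e - matTensor 1 (P s) ∈ tensorCone P n) (y : Matrix (Fin n) (Fin n) V)
    (hy : star y = y) : ∃ r : ℝ, (r : ℂ) • e + y ∈ tensorCone P n := by
  have hex : ∀ a b, ∃ c : σ → ℂ, ∑ s, c s • P s = y a b := fun a b => by
    rw [← Submodule.mem_span_range_iff_exists_fun, hspan]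
    trivial
  choose c hc using hex
  let D : σ → Matrix (Fin n) (Fin n) ℂ := fun s => Matrix.of fun a b => c a b s
  have hyD : y = ∑ s, matTensor (D s) (P s) := by
    ext1 a b
    rw [← hc, Matrix.sum_apply]
    rfl
  choose r hr hrD using fun s => exists_pos_smul_one_add_posSemidef
    (N := (1 / 2 : ℂ) • (D s + (D s)ᴴ)) (by
      rw [Matrix.IsHermitian, Matrix.conjTranspose_smul, Matrix.conjTranspose_add,
        Matrix.conjTranspose_conjTranspose, add_comm]
      simp)
  have hy2 : y = ∑ s, matTensor ((1 / 2 : ℂ) • (D s + (D s)ᴴ)) (P s) := by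
    simp only [matTensor_smul, matTensor_add]
    rw [← Finset.smul_sum, Finset.sum_add_distrib, ← hyD]
    have h3 : ∑ s, matTensor (D s)ᴴ (P s) = y := by
      rw [← hy]
      conv_rhs => rw [hyD]
      rw [star_sum]
      exact Finset.sum_congr rfl fun s _ => (star_matTensor _ (hP s)).symm
    rw [h3]
    module
  have h1 : (((∑ s, r s : ℝ)) : ℂ) • e + y = ∑ s, ((r s : ℂ) • (e - matTensor 1 (P s)) +
      matTensor ((r s : ℂ) • 1 + (1 / 2 : ℂ) • (D s + (D s)ᴴ)) (P s)) := by
    conv_lhs => rw [hy2]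
    rw [Complex.ofReal_sum, Finset.sum_smul, ← Finset.sum_add_distrib]
    refine Finset.sum_congr rfl fun s _ => ?_
    rw [matTensor_add, matTensor_smul (r s : ℂ)]
    module
  refine ⟨∑ s, r s, ?_⟩
  rw [h1]
  exact sum_mem_tensorCone _ _ fun s _ =>
    add_mem_tensorCone (smul_mem_tensorCone (hr s).le (he s)) (matTensor_mem_tensorCone _ s (hrD s))

end TensorCone

/-! ### Faithful states and representations -/

theorem oneByOne_sum {V ι : Type*} [AddCommGroup V] (t : Finset ι) (x : ι → V) :
    OSDual.oneByOne (∑ s ∈ t, x s) = ∑ s ∈ t, OSDual.oneByOne (x s) := by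
  ext i j
  rw [Matrix.sum_apply]
  rfl

/-- A unital functional that is strictly positive at the generators is a faithful state. -/
theorem GeneratesMatCones.isFaithfulState {V : Type*} [AddCommGroup V] [Module ℂ V]
    [StarAddMonoid V] [StarModule ℂ V] [OperatorSystem V] {σ : Type*} [Fintype σ] {P : σ → V}
    (hP : GeneratesMatCones P) {f : OSDual V} (hf1 : f OperatorSystem.unit = 1)
    (hf : ∀ s, 0 < f (P s)) : OSDual.IsFaithfulState f := by
  have hu := (OperatorSystem.isArchimedeanMatrixOrderUnit_unit (V := V)).2 1
  have hdiag : ∀ x : V, Matrix.diagonal (fun _ : Fin 1 => x) = OSDual.oneByOne x := fun x => by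
    ext i j
    rw [Subsingleton.elim j i, Matrix.diagonal_apply_eq]
    rfl
  rw [hdiag] at hu
  have happrox : ∀ p : V, OSDual.oneByOne p ∈ matCone 1 → ∀ ε : ℝ, 0 < ε →
      ∃ c : σ → ℝ, (∀ s, 0 ≤ c s) ∧
        (ε : ℂ) • OperatorSystem.unit + p = ∑ s, (c s : ℂ) • P s := by
    intro p hp ε hε
    obtain ⟨C, hC, h⟩ := hP.exists_eq_sum _ hp ε hε
    have hc : ∀ s, 0 ≤ C s 0 0 := fun s => (hC s).diag_nonneg
    refine ⟨fun s => (C s 0 0).re, fun s => (Complex.le_def.1 (hc s)).1, ?_⟩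
    have h1 := congrFun (congrFun h 0) 0
    rw [hdiag, Matrix.sum_apply] at h1
    refine Eq.trans h1 (Finset.sum_congr rfl fun s _ => ?_)
    rw [matTensor_apply, ← Complex.eq_re_of_ofReal_le (r := 0) (by simpa using hc s)]
  choose r hr0 hr using fun s => hu.1 (-OSDual.oneByOne (P s)) (by
    have h := OSDual.star_eq_of_oneByOne_mem (hP.mem_cone s)
    ext i j
    exact (star_neg (P s)).trans (congrArg _ h))
  have hre : ∀ s, f (P s) = ((f (P s)).re : ℂ) := fun s =>
    Complex.eq_re_of_ofReal_le (r := 0) (by simpa using (hf s).le)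
  have hpos : ∀ s, 0 < (f (P s)).re := fun s => (Complex.lt_def.1 (hf s)).1
  have hval : ∀ (p : V) (ε : ℝ) (c : σ → ℝ),
      (ε : ℂ) • OperatorSystem.unit + p = ∑ s, (c s : ℂ) • P s →
        (ε : ℂ) + f p = ((∑ s, c s * (f (P s)).re : ℝ) : ℂ) := by
    intro p ε c h
    have h1 : f ((ε : ℂ) • OperatorSystem.unit + p) = f (∑ s, (c s : ℂ) • P s) := by rw [h]
    have h2 : f (∑ s, (c s : ℂ) • P s) = ∑ s, f ((c s : ℂ) • P s) :=
      _root_.map_sum (show V →ₗ[ℂ] ℂ from f) _ _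
    rw [OSDual.map_add, OSDual.map_smul, hf1, h2, smul_eq_mul, mul_one] at h1
    rw [h1, Complex.ofReal_sum]
    refine Finset.sum_congr rfl fun s _ => ?_
    rw [OSDual.map_smul, smul_eq_mul, Complex.ofReal_mul, ← hre]
  refine ⟨hf1, fun p hp => ⟨?_, fun h0 => ?_⟩⟩
  · have him : (f p).im = 0 := by
      obtain ⟨c, hc, h⟩ := happrox p hp 1 one_pos
      simpa using congrArg Complex.im (hval p 1 c h)
    have hnn : 0 ≤ (f p).re := by
      refine le_of_forall_pos_le_add fun ε hε => ?_
      obtain ⟨c, hc, h⟩ := happrox p hp ε hε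
      have h1 := congrArg Complex.re (hval p ε c h)
      rw [Complex.add_re, Complex.ofReal_re, Complex.ofReal_re] at h1
      rw [add_comm, h1]
      exact Finset.sum_nonneg fun s _ => mul_nonneg (hc s) (hpos s).le
    exact Complex.le_def.2 ⟨hnn, him.symm⟩
  · -- `ε + p = ∑ c_s P_s` gives `∑ c_s f(P_s) = ε`, so that `p ≤ ∑ c_s r_s` tends to zero with `ε`
    have hneg : -OSDual.oneByOne p ∈ matCone 1 := by
      refine hu.2 _ fun t ht => ?_
      let R : ℝ := ∑ s, r s / (f (P s)).re
      have hR : 0 ≤ R := Finset.sum_nonneg fun s _ => (div_pos (hr0 s) (hpos s)).le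
      have hε : 0 < t / (R + 1) := by positivity
      obtain ⟨c, hc, h⟩ := happrox p hp _ hε
      have h1 := hval p _ c h
      rw [h0, add_zero] at h1
      have h1' : t / (R + 1) = ∑ s, c s * (f (P s)).re := by exact_mod_cast h1
      have hcs : ∀ s, c s * r s ≤ t / (R + 1) * (r s / (f (P s)).re) := fun s => by
        have h2 : c s * (f (P s)).re ≤ t / (R + 1) := by
          rw [h1']
          exact Finset.single_le_sum (f := fun s => c s * (f (P s)).re)
            (fun s _ => mul_nonneg (hc s) (hpos s).le) (Finset.mem_univ s)
        calc c s * r s = c s * (f (P s)).re * (r s / (f (P s)).re) := by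
              have := (hpos s).ne'
              field_simp
          _ ≤ _ := mul_le_mul_of_nonneg_right h2 (div_pos (hr0 s) (hpos s)).le
      have hsum : ∑ s, c s * r s ≤ t + t / (R + 1) := by
        calc ∑ s, c s * r s ≤ t / (R + 1) * R := by
              rw [Finset.mul_sum]
              exact Finset.sum_le_sum fun s _ => hcs s
          _ ≤ t / (R + 1) * (R + 1) := mul_le_mul_of_nonneg_left (by linarith) hε.le
          _ = t := div_mul_cancel₀ _ (by positivity)
          _ ≤ _ := by linarith
      obtain ⟨c₀, hc₀, hunit⟩ := happrox 0 (zero_mem 1) 1 one_pos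
      have hunit_mem : OSDual.oneByOne (OperatorSystem.unit : V) ∈ matCone 1 := by
        rw [Complex.ofReal_one, one_smul, add_zero] at hunit
        rw [hunit, oneByOne_sum]
        exact sum_mem_matCone _ _ fun s _ => smul_mem (hc₀ s) (hP.mem_cone s)
      have h3 : (t : ℂ) • OSDual.oneByOne (OperatorSystem.unit : V) + -OSDual.oneByOne p =
          ((t + t / (R + 1) - ∑ s, c s * r s : ℝ) : ℂ) •
            OSDual.oneByOne (OperatorSystem.unit : V) +
          ∑ s, (c s : ℂ) • ((r s : ℂ) • OSDual.oneByOne (OperatorSystem.unit : V) +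
            -OSDual.oneByOne (P s)) := by
        have h4 : OSDual.oneByOne p = ∑ s, (c s : ℂ) • OSDual.oneByOne (P s) -
            ((t / (R + 1) : ℝ) : ℂ) • OSDual.oneByOne (OperatorSystem.unit : V) := by
          have h5 := congrArg OSDual.oneByOne h
          rw [oneByOne_sum] at h5
          rw [eq_sub_iff_add_eq, add_comm]
          exact h5
        rw [h4]
        simp only [smul_add, Finset.sum_add_distrib, smul_neg, Finset.sum_neg_distrib, smul_smul]
        rw [← Finset.sum_smul]
        push_cast
        module
      rw [h3]
      exact add_mem (smul_mem (by linarith) hunit_mem)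
        (sum_mem_matCone _ _ fun s _ => smul_mem (hc s) (hr s))
    have := eq_zero_of_mem_of_neg_mem hp hneg
    exact congrFun (congrFun this 0) 0

/-- For a representation `π` and `M = B⋆ B`, the sum `∑ ⟪ξ_a, π(M_{ab}) ξ_b⟫` equals
`∑_c ‖∑_a π(B_{ca}) ξ_a‖²`. -/
theorem sum_inner_nonneg_of_mem_matCone {A : Type*} [CStarAlgebra A] {S : OperatorSubsystem A}
    {H : Type*} [NormedAddCommGroup H] [InnerProductSpace ℂ H] [CompleteSpace H] {n : ℕ}
    (ξ : Fin n → H) (π : A →⋆ₐ[ℂ] (H →L[ℂ] H)) {M : Matrix (Fin n) (Fin n) S}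
    (hM : M ∈ matCone n) : 0 ≤ ∑ a, ∑ b, inner ℂ (ξ a) (π (M a b) (ξ b)) := by
  obtain ⟨B, hB⟩ := hM
  have hterm : ∀ a b, inner ℂ (ξ a) (π (M a b) (ξ b)) =
      ∑ c, inner ℂ (π (B c a) (ξ a)) (π (B c b) (ξ b)) := fun a b => by
    have h1 : (M a b : A) = ∑ c, star (B c a) * B c b := congrFun (congrFun hB a) b
    rw [h1, map_sum, sum_apply, inner_sum]
    refine Finset.sum_congr rfl fun c _ => ?_
    rw [map_mul, map_star, mul_apply_eq_comp, ContinuousLinearMap.star_eq_adjoint,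
      ContinuousLinearMap.adjoint_inner_right]
  have h2 : ∑ a, ∑ b, inner ℂ (ξ a) (π (M a b) (ξ b)) =
      ∑ c, inner ℂ (∑ a, π (B c a) (ξ a)) (∑ b, π (B c b) (ξ b)) := by
    simp only [hterm, sum_inner, inner_sum]
    rw [Finset.sum_comm]
    conv_rhs => rw [Finset.sum_comm]
    conv_rhs => enter [2, b]; rw [Finset.sum_comm]
  rw [h2]
  refine Finset.sum_nonneg fun c _ => ?_
  rw [inner_self_eq_norm_sq_to_K]
  positivity

/-! ### Operator systems spanned by the powers of free unitaries of finite order -/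

/-- `S` is spanned by the powers of unitaries `w_j` with `w_j ^ k_j = 1` which are free in the sense
that any unitaries `W_j` on a Hilbert space with `W_j ^ k_j = 1` are the images of the `w_j` under a
`⋆`-representation of the ambient C⋆-algebra. Exponents run over all of `ℕ`; since `w_j ^ 0 = 1`,
the unit needs no separate mention. -/
structure IsFreeRootSystem {A : Type*} [CStarAlgebra A] (S : OperatorSubsystem A) {J : Type}
    (k : J → ℕ) (w : J → A) : Prop where
  ne_zero : ∀ j, k j ≠ 0
  pow_eq_one : ∀ j, w j ^ k j = 1
  star_mul_self : ∀ j, star (w j) * w j = 1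
  span_eq : S.toSubmodule = Submodule.span ℂ (Set.range fun t : J × ℕ => w t.1 ^ t.2)
  exists_lift : ∀ (H : Type) [NormedAddCommGroup H] [InnerProductSpace ℂ H] [CompleteSpace H]
    (W : J → unitary (H →L[ℂ] H)), (∀ j, W j ^ k j = 1) →
      ∃ π : A →⋆ₐ[ℂ] (H →L[ℂ] H), ∀ j, π (w j) = W j

namespace IsFreeRootSystem

variable {A : Type*} [CStarAlgebra A] {S : OperatorSubsystem A} {J : Type} {k : J → ℕ} {w : J → A}

/-- The primitive root of unity `exp (2πi / k_j)`. -/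
noncomputable def zeta (k : J → ℕ) (j : J) : ℂ := Complex.exp (2 * Real.pi * Complex.I / k j)

theorem pow_mem (hS : IsFreeRootSystem S k w) (j : J) (m : ℕ) : w j ^ m ∈ S.toSubmodule := by
  rw [hS.span_eq]
  exact Submodule.subset_span ⟨(j, m), rfl⟩

theorem isPrimitiveRoot_zeta (hS : IsFreeRootSystem S k w) (j : J) :
    IsPrimitiveRoot (zeta k j) (k j) :=
  Complex.isPrimitiveRoot_exp _ (hS.ne_zero j)

theorem rootProj_mem (hS : IsFreeRootSystem S k w) (s : Σ j, Fin (k j)) :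
    rootProj (k s.1) (w s.1) (zeta k s.1 ^ (s.2 : ℕ)) ∈ S.toSubmodule := by
  refine Submodule.smul_mem _ _ (Submodule.sum_mem _ fun a _ => ?_)
  rw [smul_pow]
  exact Submodule.smul_mem _ _ (hS.pow_mem _ _)

/-- The spectral projections of the `w_j`, as elements of `S`. -/
noncomputable def proj (hS : IsFreeRootSystem S k w) (s : Σ j, Fin (k j)) : S :=
  ⟨rootProj (k s.1) (w s.1) (zeta k s.1 ^ (s.2 : ℕ)), hS.rootProj_mem s⟩

/-- The power `w_j ^ m` as an element of `S`. -/
def pow (hS : IsFreeRootSystem S k w) (j : J) (m : ℕ) : S := ⟨w j ^ m, hS.pow_mem j m⟩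

theorem pow_eq_sum (hS : IsFreeRootSystem S k w) (j : J) (m : ℕ) :
    hS.pow j m = ∑ i : Fin (k j), (zeta k j ^ (i : ℕ)) ^ m • hS.proj ⟨j, i⟩ := by
  apply Subtype.ext
  rw [AddSubmonoidClass.coe_finsetSum]
  exact pow_eq_sum_rootProj (hS.isPrimitiveRoot_zeta j) (hS.ne_zero j) (hS.pow_eq_one j) m

theorem unit_eq_sum (hS : IsFreeRootSystem S k w) (j : J) :
    (OperatorSystem.unit : S) = ∑ i : Fin (k j), hS.proj ⟨j, i⟩ := by
  have h : (OperatorSystem.unit : S) = hS.pow j 0 := Subtype.ext (pow_zero (w j)).symm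
  rw [h, hS.pow_eq_sum]
  simp

theorem proj_mem_matCone (hS : IsFreeRootSystem S k w) (s : Σ j, Fin (k j)) :
    OSDual.oneByOne (hS.proj s) ∈ matCone 1 := by
  refine ⟨Matrix.of fun _ _ => (hS.proj s : A), ?_⟩
  ext i j
  have hz : (zeta k s.1 ^ (s.2 : ℕ)) ^ k s.1 = 1 := by
    rw [← pow_mul, mul_comm, pow_mul, (hS.isPrimitiveRoot_zeta s.1).pow_eq_one, one_pow]
  simp only [OSDual.oneByOne, Matrix.map_apply, Matrix.of_apply, Matrix.mul_apply,
    Matrix.conjTranspose_apply, Finset.univ_unique, Finset.sum_singleton]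
  exact (star_mul_self_rootProj (hS.ne_zero s.1) (hS.star_mul_self s.1) (hS.pow_eq_one s.1) hz).symm

theorem span_pow_eq_top (hS : IsFreeRootSystem S k w) :
    Submodule.span ℂ (Set.range fun t : J × ℕ => hS.pow t.1 t.2) = ⊤ := by
  rw [eq_top_iff]
  rintro ⟨x, hx⟩ -
  have h : Submodule.map S.toSubmodule.subtype
      (Submodule.span ℂ (Set.range fun t : J × ℕ => hS.pow t.1 t.2)) = S.toSubmodule := by
    rw [Submodule.map_span, ← Set.range_comp]
    exact hS.span_eq.symm
  have hx' := hx
  rw [← h] at hx'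
  obtain ⟨y, hy, hyx⟩ := hx'
  have : y = ⟨x, hx⟩ := Subtype.ext hyx
  rwa [← this]

theorem span_proj_eq_top (hS : IsFreeRootSystem S k w) :
    Submodule.span ℂ (Set.range hS.proj) = ⊤ := by
  rw [eq_top_iff, ← hS.span_pow_eq_top, Submodule.span_le]
  rintro _ ⟨t, rfl⟩
  dsimp only
  rw [hS.pow_eq_sum]
  exact Submodule.sum_mem _ fun i _ => Submodule.smul_mem _ _ (Submodule.subset_span ⟨_, rfl⟩)

/-- Linear functionals `L_{ab}` on `S` for which the matrices `[L_{ab}(p_{j,i})]` are positive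
semidefinite are the coefficients of a representation. -/
theorem exists_rep (hS : IsFreeRootSystem S k w) [Fintype J] [Nonempty J] {n : ℕ}
    (L : Fin n → Fin n → S →ₗ[ℂ] ℂ)
    (hL : ∀ s, (Matrix.of fun a b => L a b (hS.proj s)).PosSemidef) :
    ∃ (H : Type) (_ : NormedAddCommGroup H) (_ : InnerProductSpace ℂ H) (_ : CompleteSpace H)
      (ξ : Fin n → H) (π : A →⋆ₐ[ℂ] (H →L[ℂ] H)),
      ∀ a b (x : S), L a b x = inner ℂ (ξ a) (π x (ξ b)) := by
  classical
  obtain ⟨H, i1, i2, i3, ξ, W, hW, h⟩ := exists_dilation k hS.ne_zero (zeta k)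
    (fun j => (hS.isPrimitiveRoot_zeta j).pow_eq_one) _ hL
    (Matrix.of fun a b => L a b OperatorSystem.unit) (fun j => by
      ext a b
      rw [Matrix.sum_apply, Matrix.of_apply, hS.unit_eq_sum j, map_sum]
      rfl)
  obtain ⟨π, hπ⟩ := hS.exists_lift H W hW
  refine ⟨H, i1, i2, i3, ξ, π, fun a b x => ?_⟩
  have hx : x ∈ Submodule.span ℂ (Set.range fun t : J × ℕ => hS.pow t.1 t.2) := by
    rw [hS.span_pow_eq_top]; trivial
  induction hx using Submodule.span_induction with
  | mem x hx =>
    obtain ⟨⟨j, m⟩, rfl⟩ := hx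
    have h1 : π (hS.pow j m : A) = ((W j ^ m : unitary (H →L[ℂ] H)) : H →L[ℂ] H) := by
      rw [SubmonoidClass.coe_pow, ← hπ, ← map_pow]; rfl
    rw [h1, h]
    dsimp only
    rw [hS.pow_eq_sum, map_sum]
    simp
  | zero => simp
  | add x y _ _ hx hy => simp [hx, hy]
  | smul c x _ hx => simp [hx]

/-- The spectral projections generate the matrix cones: a functional separating `ε + M` from the
sums `∑ C ⊗ p_{j,i}` would come from a representation, and so would be nonnegative at `M`. -/
theorem generatesMatCones (hS : IsFreeRootSystem S k w) [Fintype J] [Nonempty J] :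
    GeneratesMatCones hS.proj where
  mem_cone := hS.proj_mem_matCone
  exists_eq_sum {n} M hM ε hε := by
    classical
    let e : Matrix (Fin n) (Fin n) S := Matrix.diagonal fun _ => OperatorSystem.unit
    have hsp : ∀ s, star (hS.proj s) = hS.proj s := fun s =>
      OSDual.star_eq_of_oneByOne_mem (hS.proj_mem_matCone s)
    have he : ∀ j, e = ∑ i, matTensor 1 (hS.proj ⟨j, i⟩) := fun j => by
      rw [← matTensor_sum_right, ← hS.unit_eq_sum, matTensor_one]
    have heK : e ∈ tensorCone hS.proj n := by
      obtain ⟨j⟩ := ‹Nonempty J›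
      rw [he j]
      exact sum_mem_tensorCone _ _ fun i _ =>
        matTensor_mem_tensorCone (P := hS.proj) 1 ⟨j, i⟩ .one
    have hone : ∀ s, e - matTensor 1 (hS.proj s) ∈ tensorCone hS.proj n := by
      rintro ⟨j, i⟩
      rw [he j, ← Finset.add_sum_erase _ _ (Finset.mem_univ i), add_sub_cancel_left]
      exact sum_mem_tensorCone _ _ fun i' _ => 
        matTensor_mem_tensorCone (P := hS.proj) 1 ⟨j, i'⟩ .one
    have heM : star ((ε : ℂ) • e + M) = (ε : ℂ) • e + M := by
      have h2 : star M = M := isHermitian_of_mem hM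
      rw [star_add, star_smul, star_eq_of_mem_tensorCone hsp heK, h2, Complex.star_def,
        Complex.conj_ofReal]
    by_contra hcon
    obtain ⟨G, hG1, hG2, hG3⟩ := exists_positive_functional (tensorCone hS.proj n)
      zero_mem_tensorCone (fun _ hy _ hz => add_mem_tensorCone hy hz)
      (fun _ hr _ hy => smul_mem_tensorCone hr hy) (fun _ => star_eq_of_mem_tensorCone hsp) e heK
      (exists_smul_add_mem_tensorCone hsp hS.span_proj_eq_top hone) _ heM hcon
    -- The value of the quadratic form of `[G (E_{ab} ⊗ p_s)]` at `x` is `G (x̄ xᵀ ⊗ p_s)`.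
    obtain ⟨H, _, _, _, ξ, π, hπ⟩ := hS.exists_rep
      (fun a b => G.comp (Matrix.singleLinearMap ℂ a b)) (fun s => by
        refine posSemidef_of_forall_dotProduct_mulVec_nonneg fun x => ?_
        have hq : star x ⬝ᵥ (Matrix.of fun a b =>
            (G.comp (Matrix.singleLinearMap ℂ a b)) (hS.proj s)) *ᵥ x =
              G (matTensor (Matrix.vecMulVec (star x) x) (hS.proj s)) := by
          rw [Matrix.matrix_eq_sum_single (matTensor (Matrix.vecMulVec (star x) x) (hS.proj s))]
          simp only [map_sum, dotProduct, Matrix.mulVec, Finset.mul_sum]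
          refine Finset.sum_congr rfl fun a _ => Finset.sum_congr rfl fun b _ => ?_
          rw [matTensor_apply, ← Matrix.smul_single, map_smul, Matrix.vecMulVec_apply]
          simp
          ring
        rw [hq]
        exact hG1 _ (matTensor_mem_tensorCone _ s (Matrix.posSemidef_vecMulVec_star_self x)))
    have hGM : G M = ∑ a, ∑ b, inner ℂ (ξ a) (π (M a b) (ξ b)) := by
      conv_lhs => rw [Matrix.matrix_eq_sum_single M]
      simp only [map_sum, ← hπ]
      rfl
    have h0 := sum_inner_nonneg_of_mem_matCone ξ π hM
    rw [← hGM] at h0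
    have h1 : (0 : ℂ) < ε := by exact_mod_cast hε
    rw [map_add, map_smul, hG3, smul_eq_mul, mul_one] at hG2
    exact (add_pos_of_pos_of_nonneg h1 h0).not_ge hG2

/-- The functional with value `1 / k_j` at each of the spectral projections of `w_j` is a faithful
state. It exists as a vector state of a representation, and it vanishes at `w_j ^ a` for
`0 < a < k_j`. -/
theorem exists_isFaithfulState (hS : IsFreeRootSystem S k w) [Fintype J] [Nonempty J] :
    ∃ f : OSDual S, OSDual.IsFaithfulState f := by
  classical
  have hk : ∀ j, (0 : ℝ) < k j := fun j => by exact_mod_cast Nat.pos_of_ne_zero (hS.ne_zero j)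
  obtain ⟨H, _, _, _, ξ, W, hW, h⟩ := exists_dilation k hS.ne_zero (zeta k)
    (fun j => (hS.isPrimitiveRoot_zeta j).pow_eq_one) (n := 1)
    (fun s => (((k s.1 : ℝ)⁻¹ : ℝ) : ℂ) • 1)
    (fun s => Matrix.PosSemidef.one.smul (by exact_mod_cast (inv_pos.2 (hk s.1)).le)) 1
    (fun j => by
      dsimp only
      rw [Finset.sum_const, Finset.card_univ, Fintype.card_fin, ← Nat.cast_smul_eq_nsmul ℂ,
        smul_smul]
      have h2 : ((k j : ℕ) : ℂ) * (((k j : ℝ)⁻¹ : ℝ) : ℂ) = 1 := by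
        have := hS.ne_zero j
        push_cast
        field_simp
      rw [h2, one_smul])
  obtain ⟨π, hπ⟩ := hS.exists_lift H W hW
  let f : OSDual S := LinearMap.comp (innerSL ℂ (ξ 0)).toLinearMap
    (LinearMap.comp (ContinuousLinearMap.apply ℂ H (ξ 0)).toLinearMap
      (LinearMap.comp π.toAlgHom.toLinearMap S.toSubmodule.subtype))
  have hf : ∀ x : S, f x = inner ℂ (ξ 0) (π x (ξ 0)) := fun x => rfl
  have hfpow : ∀ j m, f (hS.pow j m) = (k j : ℂ)⁻¹ * ∑ i : Fin (k j), (zeta k j ^ m) ^ (i : ℕ) := by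
    intro j m
    have h1 : π (hS.pow j m : A) = ((W j ^ m : unitary (H →L[ℂ] H)) : H →L[ℂ] H) := by
      rw [SubmonoidClass.coe_pow, ← hπ, ← map_pow]; rfl
    rw [hf, h1, h, Finset.mul_sum]
    refine Finset.sum_congr rfl fun i _ => ?_
    rw [← pow_mul, ← pow_mul, mul_comm m]
    simp [mul_comm]
  have hf0 : ∀ j, f (hS.pow j 0) = 1 := fun j => by
    have := hS.ne_zero j
    rw [hfpow]
    simp
    field_simp
  have hfa : ∀ j a, a ≠ 0 → a < k j → f (hS.pow j a) = 0 := fun j a ha0 ha => by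
    have h2 : zeta k j ^ a ≠ 1 := (hS.isPrimitiveRoot_zeta j).pow_ne_one_of_pos_of_lt ha0 ha
    rw [hfpow, Fin.sum_univ_eq_sum_range (fun i => (zeta k j ^ a) ^ i), geom_sum_eq h2, ← pow_mul,
      mul_comm a, pow_mul, (hS.isPrimitiveRoot_zeta j).pow_eq_one]
    simp
  have hfproj : ∀ s, f (hS.proj s) = (k s.1 : ℂ)⁻¹ := fun s => by
    have h1 : hS.proj s = (k s.1 : ℂ)⁻¹ • ∑ a ∈ Finset.range (k s.1),
        ((zeta k s.1 ^ (s.2 : ℕ))⁻¹) ^ a • hS.pow s.1 a := by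
      apply Subtype.ext
      rw [Submodule.coe_smul, AddSubmonoidClass.coe_finsetSum]
      simp only [proj, rootProj, pow, smul_pow, Submodule.coe_smul]
    have h2 : ∀ (t : Finset ℕ) (x : ℕ → S), f (∑ a ∈ t, x a) = ∑ a ∈ t, f (x a) := fun t x =>
      _root_.map_sum (show S →ₗ[ℂ] ℂ from f) _ _
    rw [h1, OSDual.map_smul, h2, Finset.sum_eq_single_of_mem 0
      (Finset.mem_range.2 (Nat.pos_of_ne_zero (hS.ne_zero s.1)))]
    · rw [OSDual.map_smul, hf0]
      simp
    · intro a ha ha0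
      rw [OSDual.map_smul, hfa _ a ha0 (Finset.mem_range.1 ha), smul_zero]
  refine ⟨f, hS.generatesMatCones.isFaithfulState ?_ fun s => ?_⟩
  · obtain ⟨j⟩ := ‹Nonempty J›
    have h1 : (OperatorSystem.unit : S) = hS.pow j 0 := Subtype.ext (pow_zero (w j)).symm
    rw [h1, hf0]
  · rw [hfproj]
    have h1 : (0 : ℂ) < (((k s.1 : ℝ)⁻¹ : ℝ) : ℂ) := Complex.zero_lt_real.2 (inv_pos.2 (hk s.1))
    rwa [Complex.ofReal_inv, Complex.ofReal_natCast] at h1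

theorem isOMAX_and_isOMIN_dual (hS : IsFreeRootSystem S k w) [Fintype J] [Nonempty J] :
    IsOMAX.{u} S ∧ (∃ f : OSDual S, OSDual.IsFaithfulState f) ∧
      (∀ f : OSDual S, OSDual.IsFaithfulState f → IsArchimedeanMatrixOrderUnit f) ∧
      IsOMIN.{u} (OSDual S) :=
  ⟨hS.generatesMatCones.isOMAX, hS.exists_isFaithfulState,
    fun _ hf => hS.generatesMatCones.isArchimedeanMatrixOrderUnit_of_isFaithfulState hf,
    hS.generatesMatCones.isOMIN_dual⟩

end IsFreeRootSystem

/-! ### Full group C⋆-algebras, noncommutative cubes and prisms -/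

section GroupCStarLift

open UniformSpace

variable {G : Type u} [Group G]

/-- The universal property of the full group C⋆-algebra. -/
theorem GroupCStar.exists_lift {H : Type u} [NormedAddCommGroup H] [InnerProductSpace ℂ H]
    [CompleteSpace H] (ρ : G →* unitary (H →L[ℂ] H)) :
    ∃ π : GroupCStar G →⋆ₐ[ℂ] (H →L[ℂ] H), ∀ g, π (GroupCStar.of g) = ρ g := by
  have hcont : Continuous (GroupAlg.rep ρ) :=
    AddMonoidHomClass.continuous_of_bound (GroupAlg.rep ρ) 1 fun x => by
      rw [one_mul]; exact GroupAlg.norm_rep_le ρ x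
  let φ : GroupCStar G →+* (H →L[ℂ] H) :=
    Completion.extensionHom (GroupAlg.rep ρ : GroupAlg G →+* (H →L[ℂ] H)) hcont
  have hφc : Continuous φ := Completion.continuous_extension
  have hφ : ∀ x, φ (GroupCStar.coe x) = GroupAlg.rep ρ x := fun x =>
    Completion.extensionHom_coe (GroupAlg.rep ρ : GroupAlg G →+* (H →L[ℂ] H)) hcont x
  have hsmul : ∀ (c : ℂ) a, φ (c • a) = c • φ a := fun c a => by
    induction a using GroupCStar.induction with
    | hp => exact isClosed_eq (hφc.comp (continuous_const_smul c)) (hφc.const_smul c)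
    | h x => rw [← GroupCStar.coe_smul, hφ, hφ, map_smul]
  have hstar : ∀ a, φ (star a) = star (φ a) := fun a => by
    induction a using GroupCStar.induction with
    | hp => exact isClosed_eq (hφc.comp continuous_star) hφc.star
    | h x => rw [GroupCStar.star_coe, hφ, hφ, GroupAlg.rep_star]
  refine ⟨{ φ with
    commutes' := fun c => ?_
    map_star' := hstar }, fun g => ?_⟩
  · change φ (algebraMap ℂ _ c) = _
    rw [Algebra.algebraMap_eq_smul_one, hsmul, map_one, Algebra.algebraMap_eq_smul_one]
  · change φ (GroupCStar.of g) = _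
    rw [GroupCStar.of, hφ, GroupAlg.rep_single, one_smul]

/-- The universal property of the cyclic group of order `k`. -/
theorem ZMod.exists_monoidHom_ofAdd_one {N : Type*} [Group N] {k : ℕ} {x : N} (hx : x ^ k = 1) :
    ∃ f : Multiplicative (ZMod k) →* N, f (Multiplicative.ofAdd 1) = x := by
  let g : ℤ →+ Additive N := zmultiplesHom (Additive N) (Additive.ofMul x)
  have hg : g k = 0 := by
    rw [zmultiplesHom_apply, natCast_zsmul, ← ofMul_pow, hx, ofMul_one]
  refine ⟨AddMonoidHom.toMultiplicativeLeft (ZMod.lift k ⟨g, hg⟩), ?_⟩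
  have h1 : ZMod.lift k ⟨g, hg⟩ ((1 : ℤ) : ZMod k) = g 1 := ZMod.lift_coe k _ 1
  rw [Int.cast_one] at h1
  change (ZMod.lift k ⟨g, hg⟩ 1).toMul = x
  rw [h1, zmultiplesHom_apply, one_zsmul, toMul_ofMul]

end GroupCStarLift

theorem cubeU_sq (d : ℕ) (j : Fin d) : cubeU d j ^ 2 = 1 := by
  rw [cubeU, ← GroupCStar.of_pow, ← map_pow,
    show (Multiplicative.ofAdd (1 : ZMod 2)) ^ 2 = 1 by decide, map_one, GroupCStar.of_one]

theorem prismV_sq (k : ℕ) : prismV k ^ 2 = 1 := by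
  rw [prismV, ← GroupCStar.of_pow, ← map_pow,
    show (Multiplicative.ofAdd (1 : ZMod 2)) ^ 2 = 1 by decide, map_one, GroupCStar.of_one]

theorem isFreeRootSystem_NC {d : ℕ} (hd : d ≠ 0) :
    IsFreeRootSystem (NC d) (fun _ : Fin d => 2) (cubeU d) where
  ne_zero _ := two_ne_zero
  pow_eq_one := cubeU_sq d
  star_mul_self j := by
    rw [cubeU, GroupCStar.star_of, ← GroupCStar.of_mul, inv_mul_cancel, GroupCStar.of_one]
  span_eq := by
    refine le_antisymm (Submodule.span_le.2 ?_) (Submodule.span_le.2 ?_)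
    · rintro _ (rfl | ⟨j, rfl⟩)
      · exact Submodule.subset_span ⟨(⟨0, Nat.pos_of_ne_zero hd⟩, 0), pow_zero _⟩
      · exact Submodule.subset_span ⟨(j, 1), pow_one _⟩
    · rintro _ ⟨⟨j, m⟩, rfl⟩
      dsimp only
      rw [pow_eq_pow_mod m (cubeU_sq d j)]
      rcases Nat.mod_two_eq_zero_or_one m with h | h
      · rw [h, pow_zero]
        exact (NC d).one_mem
      · rw [h, pow_one]
        exact Submodule.subset_span (Or.inr ⟨j, rfl⟩)
  exists_lift H _ _ _ W hW := by
    choose f hf using fun j => ZMod.exists_monoidHom_ofAdd_one (hW j)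
    obtain ⟨π, hπ⟩ := GroupCStar.exists_lift (Monoid.CoprodI.lift f)
    refine ⟨π, fun j => ?_⟩
    rw [cubeU, hπ, Monoid.CoprodI.lift_of, hf]

theorem isFreeRootSystem_NCP {k : ℕ} (hk : k ≠ 0) :
    IsFreeRootSystem (NCP k) (fun b : Bool => cond b k 2)
      (fun b => cond b (prismW k) (prismV k)) where
  ne_zero b := by cases b <;> simp [hk]
  pow_eq_one b := by
    cases b
    · exact prismV_sq k
    · exact prismW_pow_self k
  star_mul_self b := by
    cases b
    · change star (prismV k) * prismV k = 1
      rw [prismV, GroupCStar.star_of, ← GroupCStar.of_mul, inv_mul_cancel, GroupCStar.of_one]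
    · exact star_prismW_mul_self k
  span_eq := by
    refine le_antisymm (Submodule.span_le.2 ?_) (Submodule.span_le.2 ?_)
    · rintro _ ((rfl | rfl) | ⟨i, _, rfl⟩)
      · exact Submodule.subset_span ⟨(true, 0), pow_zero _⟩
      · exact Submodule.subset_span ⟨(false, 1), pow_one _⟩
      · exact Submodule.subset_span ⟨(true, i), rfl⟩
    · rintro _ ⟨⟨b, m⟩, rfl⟩
      cases b
      · change prismV k ^ m ∈ (NCP k).toSubmodule
        rw [pow_eq_pow_mod m (prismV_sq k)]
        rcases Nat.mod_two_eq_zero_or_one m with h | h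
        · rw [h, pow_zero]
          exact (NCP k).one_mem
        · rw [h, pow_one]
          exact Submodule.subset_span (Or.inl (Or.inr rfl))
      · change prismW k ^ m ∈ (NCP k).toSubmodule
        rw [pow_eq_pow_mod m (prismW_pow_self k)]
        exact Submodule.subset_span (Or.inr ⟨_, Nat.mod_lt _ (Nat.pos_of_ne_zero hk), rfl⟩)
  exists_lift H _ _ _ W hW := by
    choose f hf using fun b => ZMod.exists_monoidHom_ofAdd_one (hW b)
    obtain ⟨π, hπ⟩ := GroupCStar.exists_lift (Monoid.Coprod.lift (f true) (f false))
    refine ⟨π, fun b => ?_⟩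
    cases b
    · change π (prismV k) = _
      rw [prismV, hπ, Monoid.Coprod.lift_apply_inr]
      exact congrArg _ (hf false)
    · change π (prismW k) = _
      rw [prismW, hπ, Monoid.Coprod.lift_apply_inl]
      exact congrArg _ (hf true)

theorem mainTheorem5 :
    (∀ d : ℕ, 2 ≤ d →
      IsOMAX.{u, 0} (NC d) ∧
      (∃ f : OSDual (NC d), OSDual.IsFaithfulState f) ∧
      (∀ f : OSDual (NC d), OSDual.IsFaithfulState f → IsArchimedeanMatrixOrderUnit f) ∧
      IsOMIN.{u, 0} (OSDual (NC d))) ∧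
    (∀ k : ℕ, 2 ≤ k →
      IsOMAX.{u, 0} (NCP k) ∧
      (∃ f : OSDual (NCP k), OSDual.IsFaithfulState f) ∧
      (∀ f : OSDual (NCP k), OSDual.IsFaithfulState f → IsArchimedeanMatrixOrderUnit f) ∧
      IsOMIN.{u, 0} (OSDual (NCP k))) := by
  refine ⟨fun d hd => ?_, fun k hk => ?_⟩
  · have : Nonempty (Fin d) := ⟨⟨0, by omega⟩⟩
    exact (isFreeRootSystem_NC (by omega : d ≠ 0)).isOMAX_and_isOMIN_dual
  · exact (isFreeRootSystem_NCP (by omega : k ≠ 0)).isOMAX_and_isOMIN_dual
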